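/- Let $k$ be a field, $X$ a smooth $k$-scheme, $w\in\Gamma(X,\mathcal O_X)$, and let $\mathcal E=\mathcal E_0\oplus\mathcal E_1$ be a matrix factorization of $w$: $\mathcal E_0,\mathcal E_1$ are vector bundles and $e$ is an odd $\mathcal O_X$-linear endomorphism with $e^2=w$. Write $\Omega=\Omega^1_{X/k}$ and $\mathcal J^1(\mathcal E)=(\mathcal O_X\otimes_k\mathcal E)/I^2(\mathcal O_X\otimes_k\mathcal E)$, where $I$ is the kernel of the multiplication $\mathcal O_X\otimes_k\mathcal O_X\to\mathcal O_X$; it is an $\mathcal O_X$-module through the left factor, and $a\boxtimes s$ denotes the class of $a\otimes s$. There are maps $\mathcal J^1(\mathcal E)\to\mathcal E$, $a\boxtimes s\mapsto as$, and $\Omega\otimes\mathcal E\to\mathcal J^1(\mathcal E)$, $da\otimes s\mapsto a\boxtimes s-1\boxtimes as$. For $n\ge 0$ (for instance $n=\dim X$) let $$\mathcal At(\mathcal E)=\bigoplus_{q<n}\Omega^{\otimes q}\otimes\mathcal J^1(\mathcal E)\ \oplus\ \Omega^{\otimes n}\otimes\mathcal E ,$$ $\mathbb Z/2$-graded so that the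 part coming from $\mathcal E_i$ and $\Omega^{\otimes q}$ has degree $i+q$, with the differential $d=B_{dw}-m\gamma+e\gamma$. Here $\gamma=(-1)^q$ on the $q$-th summand; $B_{dw}$ sends $\omega_1\otimes\dots\otimes\omega_q\otimes x$ to $\sum_{j=0}^q(-1)^j\omega_1\otimes\dots\otimes\omega_j\otimes dw\otimes\omega_{j+1}\otimes\dots\otimes\omega_q\otimes x$, followed by $\mathcal J^1(\mathcal E)\to\mathcal E$ if $q+1=n$, and is zero on the summand $q=n$; $m$ maps the $q$-th summand to the $(q-1)$-st by applying $\Omega\otimes\mathcal J^1(\mathcal E)\to\Omega\otimes\mathcal E\to\mathcal J^1(\mathcal E)$ (or, if $q=n$, $\Omega\otimes\mathcal E\to\mathcal J^1(\mathcal E)$) to the last two factors; and $e$ acts on $\mathcal J^1(\mathcal E)$ by $a\boxtimes s\mapsto a\boxtimes es$ and on $\mathcal E$ by $e$. Let $U_1,\dots,U_N$ be an open cover of $X$ and, for each $j$, let $\nabla_j$ be a connection on $\mathcal E|_{U_j}$ preserving $\mathcal E_0$ and $\mathcal E_1$. Put $[e,\nabla_j]=\nabla_je-(1\otimes e)\nabla_j:\mathcal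 E|_{U_j}\to\Omega\otimes\mathcal E|_{U_j}$ (the graded commutator, $e$ acting on $\Omega\otimes\mathcal E$ by $-1\otimes e$). Let $\sigma_j:\Omega^{\otimes q}\otimes\mathcal E\to\Omega^{\otimes q}\otimes\mathcal J^1(\mathcal E)$ be induced by the splitting $s\mapsto 1\boxtimes s+\nabla_js$ for $q<n$, the identity of $\Omega^{\otimes n}\otimes\mathcal E$ for $q=n$, and zero for $q>n$. For $i_0<\dots<i_p$ put $U_{i_0\dots i_p}=U_{i_0}\cap\dots\cap U_{i_p}$, let $j_{i_0\dots i_p}$ be its inclusion into $X$, and $\mathcal At(\mathcal E)_{i_0\dots i_p}=(j_{i_0\dots i_p})_*\bigl(\mathcal At(\mathcal E)|_{U_{i_0\dots i_p}}\bigr)$. Then for all $p\ge 0$ and $i_0<\dots<i_p$ the formula $$f_{i_0\dots i_p}=\sigma_{i_0}\sum_{k_0,\dots,k_p\ge 0}(-1)^{\sum_{j=0}^p j(k_j+1)}[e,\nabla_{i_0}]^{k_0}(\nabla_{i_0}-\nabla_{i_1})[e,\nabla_{i_1}]^{k_1}(\nabla_{i_1}-\nabla_{i_2})\cdots(\nabla_{i_{p-1}}-\nabla_{i_p})[e,\nabla_{i_p}]^{k_p}$$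 (the rightmost factor is applied first; every factor is applied to the tensor factor $\mathcal E$, so that its form is placed directly before $\mathcal E$) defines a morphism of $\mathcal O_X$-modules $f_{i_0\dots i_p}:\mathcal E\to\mathcal At(\mathcal E)_{i_0\dots i_p}$ of degree $p$ modulo $2$. These morphisms satisfy $$d\,f_{i_0\dots i_p}-(-1)^pf_{i_0\dots i_p}\,e=\sum_{j=0}^p(-1)^jf_{i_0\dots\widehat{i_j}\dots i_p}\big|_{U_{i_0\dots i_p}}\quad(p\ge 1),\qquad d\,f_{i_0}-f_{i_0}\,e=0 .$$ Consequently $f=\sum_p\sum_{i_0<\dots<i_p}(-1)^{p(p-1)/2}f_{i_0\dots i_p}$ is a closed morphism of degree $0$ from $\mathcal E$ to the Čech complex $\bigoplus_p\bigoplus_{i_0<\dots<i_p}\mathcal At(\mathcal E)_{i_0\dots i_p}$, where degree $b$ elements of $\mathcal At(\mathcal E)$ in the component $i_0\dots i_p$ have degree $b-p$ modulo $2$: it satisfies $(c+\gamma' d)f=fe$, where $c$ is the Čech differential, $(cx)_{i_0\dots i_p}=\sum_j(-1)^jx_{i_0\dots\widehat{i_j}\dots i_p}|_{U_{i_0\dots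 i_p}}$ for $p\ge1$ and $(cx)_{i_0}=0$, and $\gamma'$ is $(-1)^p$ on the component $i_0\dots i_p$. -/

import Mathlib

open CategoryTheory TensorProduct AlgebraicGeometry

universe u

noncomputable section

namespace MatFact

section Algebra

variable (k : Type u) [CommRing k] {A : Type u} [CommRing A] [Algebra k A]

/-- `Ω ⊗ N`. -/
abbrev OmegaTensor (N : ModuleCat.{u} A) : ModuleCat.{u} A := ModuleCat.of A (Ω[A⁄k] ⊗[A] N)

/-- `Forms k q N` is `Ω^{⊗ q} ⊗ N`, tensor products over `A`; the factors are nested as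
`Ω ⊗ (Ω ⊗ ⋯ (Ω ⊗ N))`. -/
def Forms : ℕ → ModuleCat.{u} A → ModuleCat.{u} A
  | 0, N => N
  | q + 1, N => Forms q (OmegaTensor k N)

namespace Forms

/-- The tautological identification `Ω^{⊗ q} ⊗ (Ω ⊗ N) = Ω^{⊗ (q + 1)} ⊗ N`. -/
def shift (q : ℕ) (N : ModuleCat.{u} A) : Forms k q (OmegaTensor k N) ≃ₗ[A] Forms k (q + 1) N :=
  LinearEquiv.refl A (Forms k q (OmegaTensor k N))

/-- `1 ⊗ f : Ω^{⊗ q} ⊗ N → Ω^{⊗ q} ⊗ N'`. -/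
def map : ∀ (q : ℕ) {N N' : ModuleCat.{u} A}, (N →ₗ[A] N') → (Forms k q N →ₗ[A] Forms k q N')
  | 0, _, _, f => f
  | q + 1, N, N', f => (shift k q N').toLinearMap ∘ₗ
      map q (N := OmegaTensor k N) (N' := OmegaTensor k N') (f.lTensor Ω[A⁄k]) ∘ₗ
      (shift k q N).symm.toLinearMap

/-- `n ↦ η ⊗ n`. -/
def cons (η : Ω[A⁄k]) (N : ModuleCat.{u} A) : N →ₗ[A] OmegaTensor k N :=
  TensorProduct.mk A Ω[A⁄k] N η

/-- `ω₁ ⊗ ⋯ ⊗ ω_q ⊗ n ↦ ∑_{j = 0}^{q} (-1) ^ j ω₁ ⊗ ⋯ ⊗ ω_j ⊗ η ⊗ ω_{j+1} ⊗ ⋯ ⊗ ω_q ⊗ n`. -/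
def insert (η : Ω[A⁄k]) : ∀ (q : ℕ) (N : ModuleCat.{u} A), Forms k q N →ₗ[A] Forms k (q + 1) N
  | 0, N => (shift k 0 N).toLinearMap ∘ₗ cons k η N
  | q + 1, N =>
    (shift k (q + 1) N).toLinearMap ∘ₗ insert η q (OmegaTensor k N) ∘ₗ
        (shift k q N).symm.toLinearMap +
      (-1 : A) ^ (q + 1) • ((shift k (q + 1) N).toLinearMap ∘ₗ map k (q + 1) (cons k η N))

lemma insert_succ_apply (η : Ω[A⁄k]) (q : ℕ) (N : ModuleCat.{u} A) (x : Forms k (q + 1) N) :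
    insert k η (q + 1) N x = shift k (q + 1) N (insert k η q (OmegaTensor k N)
      ((shift k q N).symm x)) +
      (-1 : A) ^ (q + 1) • shift k (q + 1) N (map k (q + 1) (cons k η N) x) := rfl

end Forms

section PrincipalParts

variable (M : Type u) [AddCommGroup M] [Module k M] [Module A M] [IsScalarTower k A M]

variable (A) in
/-- The `A`-linear map `A ⊗ A → A ⊗ M`, `a ⊗ b ↦ a ⊗ b m`. -/
def extAct {M : Type u} [AddCommGroup M] [Module k M] [Module A M] [IsScalarTower k A M] (m : M) :
    A ⊗[k] A →ₗ[A] A ⊗[k] M :=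
  ((LinearMap.toSpanSingleton A M m).restrictScalars k).baseChange A

variable (A) in
/-- The submodule `I² (A ⊗ M)` of `A ⊗ M`, where `I` is the kernel of the multiplication
`A ⊗ A → A`. -/
def jetRel : Submodule A (A ⊗[k] M) :=
  Submodule.span A {z | ∃ t ∈ KaehlerDifferential.ideal k A ^ 2, ∃ m : M, z = extAct k A m t}

variable (A) in
/-- `J¹(M) = (A ⊗ A) / I² ⊗_A M = (A ⊗ M) / I² (A ⊗ M)`, an `A`-module through the left factor. -/
abbrev Jet : ModuleCat.{u} A := ModuleCat.of A ((A ⊗[k] M) ⧸ jetRel k A M)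

variable {M}

variable (A) in
lemma extAct_tmul (m : M) (a b : A) : extAct k A m (a ⊗ₜ b) = a ⊗ₜ (b • m) := rfl

variable (A M) in
lemma jetRel_eq : jetRel k A M = Submodule.span A
    {z | ∃ (a b : A) (m : M), z = (a * b) ⊗ₜ[k] m - a ⊗ₜ (b • m) - b ⊗ₜ (a • m) +
      1 ⊗ₜ ((a * b) • m)} := by
  have key (a b : A) (m : M) : extAct k A m ((1 ⊗ₜ a - a ⊗ₜ 1) * (1 ⊗ₜ b - b ⊗ₜ 1)) =
      (a * b) ⊗ₜ[k] m - a ⊗ₜ (b • m) - b ⊗ₜ (a • m) + 1 ⊗ₜ ((a * b) • m) := by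
    simp only [mul_sub, sub_mul, Algebra.TensorProduct.tmul_mul_tmul, one_mul, mul_one, map_sub,
      extAct_tmul, one_smul]
    abel
  apply le_antisymm
  · refine Submodule.span_le.2 ?_
    rintro _ ⟨t, ht, m, rfl⟩
    rw [pow_two, ← KaehlerDifferential.span_range_eq_ideal, Ideal.span_mul_span'] at ht
    induction ht using Submodule.span_induction generalizing m with
    | mem x hx =>
      obtain ⟨_, ⟨a, rfl⟩, _, ⟨b, rfl⟩, rfl⟩ := hx
      exact Submodule.subset_span ⟨a, b, m, key a b m⟩
    | zero => simp
    | add x y _ _ hx hy => rw [map_add]; exact add_mem (hx m) (hy m)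
    | smul c x _ hx =>
      induction c with
      | zero => simp
      | add c d hc hd => rw [add_smul, map_add]; exact add_mem hc hd
      | tmul c d =>
        have h (x : A ⊗[k] A) : extAct k A m ((c ⊗ₜ[k] d) * x) = c • extAct k A (d • m) x := by
          induction x with
          | zero => simp
          | add x y hx' hy' => rw [mul_add, map_add, hx', hy', map_add, smul_add]
          | tmul x y =>
            rw [Algebra.TensorProduct.tmul_mul_tmul, extAct_tmul, extAct_tmul, smul_tmul',
              smul_eq_mul, mul_comm d y, mul_smul]
        rw [smul_eq_mul, h]
        exact Submodule.smul_mem _ _ (hx _)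
  · refine Submodule.span_le.2 ?_
    rintro _ ⟨a, b, m, rfl⟩
    refine Submodule.subset_span ⟨_, ?_, m, (key a b m).symm⟩
    rw [pow_two]
    exact Ideal.mul_mem_mul (KaehlerDifferential.one_smul_sub_smul_one_mem_ideal k a)
      (KaehlerDifferential.one_smul_sub_smul_one_mem_ideal k b)

namespace Jet

/-- The class of `a ⊠ m`. -/
def mk (a : A) (m : M) : Jet k A M := (jetRel k A M).mkQ (a ⊗ₜ m)

lemma mk_rel (a b : A) (m : M) :
    mk k (a * b) m - mk k a (b • m) - mk k b (a • m) + mk k 1 ((a * b) • m) = 0 := by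
  have : (a * b) ⊗ₜ[k] m - a ⊗ₜ (b • m) - b ⊗ₜ (a • m) + 1 ⊗ₜ ((a * b) • m) ∈ jetRel k A M := by
    rw [jetRel_eq]
    exact Submodule.subset_span ⟨a, b, m, rfl⟩
  have h := (Submodule.Quotient.mk_eq_zero _).2 this
  exact h

lemma smul_mk (a b : A) (m : M) : a • mk k b m = mk k (a * b) m := rfl

lemma mk_smul (c : k) (a : A) (m : M) : mk k (c • a) m = c • mk k a m := rfl

lemma mk_smul_right (c : k) (a : A) (m : M) : mk k a (c • m) = c • mk k a m := by
  rw [mk, tmul_smul]; rfl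

lemma mk_add (a : A) (m m' : M) : mk k a (m + m') = mk k a m + mk k a m' := by
  rw [mk, tmul_add]; rfl

lemma add_mk (a b : A) (m : M) : mk k (a + b) m = mk k a m + mk k b m := by
  rw [mk, add_tmul]; rfl

@[elab_as_elim]
lemma induction {P : Jet k A M → Prop} (x : Jet k A M) (h0 : P 0) (h1 : ∀ a m, P (mk k a m))
    (h2 : ∀ x y, P x → P y → P (x + y)) : P x := by
  obtain ⟨x, rfl⟩ := Submodule.mkQ_surjective _ x
  induction x with
  | zero => simpa using h0
  | add x y hx hy => rw [map_add]; exact h2 _ _ hx hy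
  | tmul a m => exact h1 a m

variable (A M) in
/-- The multiplication `J¹(M) → M`, `a ⊠ m ↦ a m`. -/
def mul : Jet k A M →ₗ[A] M :=
  (jetRel k A M).liftQ ((LinearMap.id : M →ₗ[k] M).liftBaseChange A) (by
    rw [jetRel_eq, Submodule.span_le]
    rintro _ ⟨a, b, m, rfl⟩
    simp [mul_smul, smul_comm a b m])

lemma mul_mk (a : A) (m : M) : mul k A M (mk k a m) = a • m :=
  LinearMap.liftBaseChange_tmul ..

/-- `1 ⊠ e : J¹(M) → J¹(N)`, `a ⊠ m ↦ a ⊠ e m`. -/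
def map {N : Type u} [AddCommGroup N] [Module k N] [Module A N] [IsScalarTower k A N]
    (e : M →ₗ[A] N) : Jet k A M →ₗ[A] Jet k A N :=
  Submodule.mapQ (jetRel k A M) (jetRel k A N)
    ((e.restrictScalars k).baseChange A) (by
      rw [jetRel_eq, Submodule.span_le]
      rintro _ ⟨a, b, m, rfl⟩
      rw [jetRel_eq]
      refine Submodule.subset_span ⟨a, b, e m, ?_⟩
      simp)

lemma map_mk {N : Type u} [AddCommGroup N] [Module k N] [Module A N] [IsScalarTower k A N]
    (e : M →ₗ[A] N) (a : A) (m : M) : map k e (mk k a m) = mk k a (e m) := rfl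

variable (A M) in
/-- The inclusion `Ω ⊗ M = (I / I²) ⊗ M → J¹(M)`, `da ⊗ m ↦ a ⊠ m - 1 ⊠ a m`. -/
def incl : OmegaTensor k (ModuleCat.of A M) →ₗ[A] Jet k A M :=
  TensorProduct.lift (Derivation.liftKaehlerDifferential (M := M →ₗ[A] Jet k A M)
    (Derivation.mk'
      { toFun a :=
          { toFun m := mk k a m - mk k 1 (a • m)
            map_add' m m' := by rw [smul_add, mk_add, mk_add]; abel
            map_smul' c m := by
              have h := mk_rel k c a m
              rw [RingHom.id_apply, smul_sub, smul_mk, smul_mk, mul_one, smul_smul, mul_comm a c]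
              rw [← sub_eq_zero, ← neg_eq_zero, ← h]
              abel }
        map_add' a b := by
          ext m
          simp only [LinearMap.coe_mk, AddHom.coe_mk, LinearMap.add_apply, add_smul, mk_add,
            add_mk]
          abel
        map_smul' c a := by
          ext m
          simp only [LinearMap.coe_mk, AddHom.coe_mk, LinearMap.smul_apply, RingHom.id_apply]
          rw [smul_sub, mk_smul, smul_assoc, mk_smul_right] }
      (fun a b => by
        ext m
        have h := mk_rel k a b m
        change mk k (a * b) m - mk k 1 ((a * b) • m) =
          a • (mk k b m - mk k 1 (b • m)) + b • (mk k a m - mk k 1 (a • m))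
        rw [smul_sub, smul_sub, smul_mk, smul_mk, smul_mk, smul_mk, mul_one, mul_one,
          mul_comm b a, ← sub_eq_zero, ← neg_eq_zero, ← h]
        abel)))

lemma incl_tmul (a : A) (m : M) :
    incl k A M (KaehlerDifferential.D k A a ⊗ₜ m) = mk k a m - mk k 1 (a • m) := by
  rw [incl, TensorProduct.lift.tmul, Derivation.liftKaehlerDifferential_comp_D]
  rfl

end Jet

end PrincipalParts

section Connection

variable (A) in
/-- A connection `∇ : M → Ω ⊗ M`; additivity and the Leibniz rule imply `k`-linearity. -/
structure Connection (M : Type u) [AddCommGroup M] [Module A M] where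
  toFun : M →+ Ω[A⁄k] ⊗[A] M
  leibniz : ∀ (a : A) (m : M), toFun (a • m) = KaehlerDifferential.D k A a ⊗ₜ m + a • toFun m

namespace Connection

variable {k}

section

variable {M : Type u} [AddCommGroup M] [Module A M]

/-- The connection on `M₀ ⊕ M₁` with graded components `c₀` and `c₁`. -/
def prod {M₀ M₁ : Type u} [AddCommGroup M₀] [Module A M₀] [AddCommGroup M₁] [Module A M₁]
    (c₀ : Connection k A M₀) (c₁ : Connection k A M₁) : Connection k A (M₀ × M₁) where
  toFun := ((LinearMap.inl A M₀ M₁).lTensor Ω[A⁄k]).toAddMonoidHom.comp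
      (c₀.toFun.comp (AddMonoidHom.fst M₀ M₁)) +
    ((LinearMap.inr A M₀ M₁).lTensor Ω[A⁄k]).toAddMonoidHom.comp
      (c₁.toFun.comp (AddMonoidHom.snd M₀ M₁))
  leibniz a m := by
    change (LinearMap.inl A M₀ M₁).lTensor Ω[A⁄k] (c₀.toFun (a • m.1)) +
      (LinearMap.inr A M₀ M₁).lTensor Ω[A⁄k] (c₁.toFun (a • m.2)) =
      KaehlerDifferential.D k A a ⊗ₜ m + a • ((LinearMap.inl A M₀ M₁).lTensor Ω[A⁄k]
        (c₀.toFun m.1) + (LinearMap.inr A M₀ M₁).lTensor Ω[A⁄k] (c₁.toFun m.2))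
    have h : KaehlerDifferential.D k A a ⊗ₜ[A] m = KaehlerDifferential.D k A a ⊗ₜ[A]
        (LinearMap.inl A M₀ M₁ m.1) + KaehlerDifferential.D k A a ⊗ₜ[A]
        (LinearMap.inr A M₀ M₁ m.2) := by
      rw [← tmul_add]; simp
    rw [c₀.leibniz, c₁.leibniz, map_add, map_add, map_smul, map_smul, LinearMap.lTensor_tmul,
      LinearMap.lTensor_tmul, h, smul_add]
    abel

/-- The commutator `[∇, e] = ∇ e - (1 ⊗ e) ∇`. -/
def bracket (c : Connection k A M) (e : M →ₗ[A] M) : M →ₗ[A] Ω[A⁄k] ⊗[A] M where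
  toFun m := c.toFun (e m) - e.lTensor Ω[A⁄k] (c.toFun m)
  map_add' m m' := by simp only [map_add]; abel
  map_smul' a m := by
    rw [map_smul, c.leibniz, c.leibniz, map_add, map_smul, LinearMap.lTensor_tmul, RingHom.id_apply,
      smul_sub]
    abel

/-- The difference `∇ - ∇'`. -/
def diff (c c' : Connection k A M) : M →ₗ[A] Ω[A⁄k] ⊗[A] M where
  toFun m := c.toFun m - c'.toFun m
  map_add' m m' := by simp only [map_add]; abel
  map_smul' a m := by
    rw [c.leibniz, c'.leibniz, RingHom.id_apply, smul_sub]
    abel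

end

/-- The splitting `M → J¹(M)`, `m ↦ 1 ⊠ m + ∇ m`, of the multiplication `J¹(M) → M`. -/
def splitting {M : Type u} [AddCommGroup M] [Module k M] [Module A M] [IsScalarTower k A M]
    (c : Connection k A M) : M →ₗ[A] Jet k A M where
  toFun m := Jet.mk k 1 m + Jet.incl k A M (c.toFun m)
  map_add' m m' := by rw [Jet.mk_add, map_add, map_add]; abel
  map_smul' a m := by
    rw [c.leibniz, map_add, Jet.incl_tmul, map_smul, RingHom.id_apply, smul_add, Jet.smul_mk,
      mul_one]
    abel

end Connection

end Connection

section Atiyah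

variable (M : Type u) [AddCommGroup M] [Module k M] [Module A M] [IsScalarTower k A M]

variable (A) in
/-- `Coeff k A M n q` is `J¹(M)` if `q < n`, `M` if `q = n`, and `0` if `q > n`. -/
def Coeff : ℕ → ℕ → ModuleCat.{u} A
  | 0, 0 => ModuleCat.of A M
  | 0, _ + 1 => ModuleCat.of A PUnit
  | _ + 1, 0 => Jet k A M
  | n + 1, q + 1 => Coeff n q

namespace Coeff

variable (A) in
/-- The map from the `q`-th to the `(q + 1)`-st coefficient module: the identity of `J¹(M)`, the
multiplication `J¹(M) → M`, or zero. -/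
def proj : ∀ n q : ℕ, Coeff k A M n q →ₗ[A] Coeff k A M n (q + 1)
  | 0, _ => 0
  | 1, 0 => Jet.mul k A M
  | _ + 2, 0 => (LinearMap.id : Jet k A M →ₗ[A] Jet k A M)
  | n + 1, q + 1 => proj n q

variable (A) in
/-- The map `Ω ⊗ J¹(M) → Ω ⊗ M → J¹(M)` if `q + 1 < n`, the inclusion `Ω ⊗ M → J¹(M)` if
`q + 1 = n`, and zero if `q + 1 > n`. -/
def lower : ∀ n q : ℕ, OmegaTensor k (Coeff k A M n (q + 1)) →ₗ[A] Coeff k A M n q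
  | 0, _ => 0
  | 1, 0 => Jet.incl k A M
  | _ + 2, 0 => Jet.incl k A M ∘ₗ (Jet.mul k A M).lTensor Ω[A⁄k]
  | n + 1, q + 1 => lower n q

variable {M}

/-- The map of coefficient modules induced by `f : M → M'`. -/
def map {M' : Type u} [AddCommGroup M'] [Module k M'] [Module A M'] [IsScalarTower k A M']
    (f : M →ₗ[A] M') : ∀ n q : ℕ, Coeff k A M n q →ₗ[A] Coeff k A M' n q
  | 0, 0 => f
  | 0, _ + 1 => 0
  | _ + 1, 0 => Jet.map k f
  | n + 1, q + 1 => map f n q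

/-- The splitting `M → J¹(M)` if `q < n`, the identity of `M` if `q = n`, zero if `q > n`. -/
def split (c : Connection k A M) : ∀ n q : ℕ, M →ₗ[A] Coeff k A M n q
  | 0, 0 => LinearMap.id
  | 0, _ + 1 => 0
  | _ + 1, 0 => c.splitting
  | n + 1, q + 1 => split c n q

end Coeff

variable (A) in
/-- `At(M) = ⨁_{q < n} Ω^{⊗ q} ⊗ J¹(M) ⊕ Ω^{⊗ n} ⊗ M`, as the product over all `q` of
`Ω^{⊗ q}` tensored with the `q`-th coefficient module, which vanishes if `q > n`. -/
abbrev At (n : ℕ) : Type u := ∀ q : ℕ, Forms k q (Coeff k A M n q)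

namespace At

variable (n : ℕ)

variable (A) in
/-- The grading operator `γ`, which is `(-1) ^ q` on `q`-forms. -/
def gamma : At k A M n →ₗ[A] At k A M n :=
  LinearMap.pi fun q => (-1 : A) ^ q • LinearMap.proj q

variable (A) in
/-- The map `m`, induced by the multiplication `J¹(M) → M` and the inclusion `Ω ⊗ M → J¹(M)`. -/
def m : At k A M n →ₗ[A] At k A M n :=
  LinearMap.pi fun q => Forms.map k q (Coeff.lower k A M n q) ∘ₗ
    (Forms.shift k q (Coeff k A M n (q + 1))).symm.toLinearMap ∘ₗ LinearMap.proj (q + 1)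

/-- The map `B`, which inserts `η` into the tensor factors `Ω`. -/
def B (η : Ω[A⁄k]) : At k A M n →ₗ[A] At k A M n :=
  LinearMap.pi fun
    | 0 => 0
    | q + 1 => Forms.map k (q + 1) (Coeff.proj k A M n q) ∘ₗ
        Forms.insert k η q (Coeff k A M n q) ∘ₗ LinearMap.proj q

variable {M}

/-- The map `1 ⊗ f : At(M) → At(M')`. -/
def map {M' : Type u} [AddCommGroup M'] [Module k M'] [Module A M'] [IsScalarTower k A M']
    (f : M →ₗ[A] M') : At k A M n →ₗ[A] At k A M' n :=
  LinearMap.pi fun q => Forms.map k q (Coeff.map k f n q) ∘ₗ LinearMap.proj q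

/-- The differential `B - m γ + e γ`, where `B` inserts `dw`. -/
def d (w : A) (e : M →ₗ[A] M) : At k A M n →ₗ[A] At k A M n :=
  B k M n (KaehlerDifferential.D k A w) - m k A M n ∘ₗ gamma k A M n + map k n e ∘ₗ gamma k A M n

end At

end Atiyah

end Algebra

section BaseChange

variable (k : Type u) [CommRing k] {A B : Type u} [CommRing A] [Algebra k A] [CommRing B]
  [Algebra k B] (ρ : A →ₐ[k] B)

/-- The map `Ω_A → Ω_B`, `a da' ↦ ρ a d (ρ a')`. -/
def kaehlerRes : Ω[A⁄k] →ₛₗ[(ρ : A →+* B)] Ω[B⁄k] :=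
  letI : Algebra A B := (ρ : A →+* B).toAlgebra
  haveI : IsScalarTower k A B := .of_algebraMap_eq' ρ.comp_algebraMap.symm
  { toFun := KaehlerDifferential.map k k A B
    map_add' := map_add _
    map_smul' := map_smul (KaehlerDifferential.map k k A B) }

lemma kaehlerRes_D (a : A) :
    kaehlerRes k ρ (KaehlerDifferential.D k A a) = KaehlerDifferential.D k B (ρ a) := by
  let _ : Algebra A B := (ρ : A →+* B).toAlgebra
  have : IsScalarTower k A B := .of_algebraMap_eq' ρ.comp_algebraMap.symm
  exact KaehlerDifferential.map_D k k A B a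

/-- The map `Ω_A ⊗ N → Ω_B ⊗ N'` induced by a `ρ`-semilinear map `N → N'`. -/
def omegaRes {N N' : Type u} [AddCommGroup N] [Module A N] [AddCommGroup N'] [Module B N']
    (g : N →ₛₗ[(ρ : A →+* B)] N') : Ω[A⁄k] ⊗[A] N →ₛₗ[(ρ : A →+* B)] Ω[B⁄k] ⊗[B] N' :=
  TensorProduct.map (kaehlerRes k ρ) g

lemma omegaRes_tmul {N N' : Type u} [AddCommGroup N] [Module A N] [AddCommGroup N'] [Module B N']
    (g : N →ₛₗ[(ρ : A →+* B)] N') (ω : Ω[A⁄k]) (x : N) :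
    omegaRes k ρ g (ω ⊗ₜ x) = kaehlerRes k ρ ω ⊗ₜ g x := rfl

lemma omegaRes_lTensor {N N' P P' : Type u} [AddCommGroup N] [Module A N] [AddCommGroup N']
    [Module B N'] [AddCommGroup P] [Module A P] [AddCommGroup P'] [Module B P']
    {g : N →ₛₗ[(ρ : A →+* B)] N'} {h : P →ₛₗ[(ρ : A →+* B)] P'} {f : N →ₗ[A] P}
    {f' : N' →ₗ[B] P'} (H : ∀ x, h (f x) = f' (g x)) (y : Ω[A⁄k] ⊗[A] N) :
    omegaRes k ρ h (f.lTensor Ω[A⁄k] y) = f'.lTensor Ω[B⁄k] (omegaRes k ρ g y) := by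
  induction y with
  | zero => simp only [map_zero]
  | add x y hx hy => simp only [map_add, hx, hy]
  | tmul ω x => rw [LinearMap.lTensor_tmul, omegaRes_tmul, omegaRes_tmul, LinearMap.lTensor_tmul, H]

namespace Forms

variable {N P : ModuleCat.{u} A} {N' P' : ModuleCat.{u} B}

/-- The map `Ω_A^{⊗ q} ⊗ N → Ω_B^{⊗ q} ⊗ N'` induced by a `ρ`-semilinear map `N → N'`. -/
def res : ∀ (q : ℕ) {N : ModuleCat.{u} A} {N' : ModuleCat.{u} B}, (N →ₛₗ[(ρ : A →+* B)] N') →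
    (Forms k q N →ₛₗ[(ρ : A →+* B)] Forms k q N')
  | 0, _, _, g => g
  | q + 1, N, N', g => res q (N := OmegaTensor k N) (N' := OmegaTensor k N') (omegaRes k ρ g)

lemma res_shift (q : ℕ) (g : N →ₛₗ[(ρ : A →+* B)] N') (x : Forms k q (OmegaTensor k N)) :
    res k ρ (q + 1) g (shift k q N x) = shift k q N' (res k ρ q (N := OmegaTensor k N)
      (N' := OmegaTensor k N') (omegaRes k ρ g) x) := rfl

lemma res_map (q : ℕ) {N P : ModuleCat.{u} A} {N' P' : ModuleCat.{u} B}
    {g : N →ₛₗ[(ρ : A →+* B)] N'} {h : P →ₛₗ[(ρ : A →+* B)] P'}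
    {f : N →ₗ[A] P} {f' : N' →ₗ[B] P'} (H : ∀ x, h (f x) = f' (g x)) (x : Forms k q N) :
    res k ρ q h (map k q f x) = map k q f' (res k ρ q g x) := by
  induction q generalizing N N' P P' with
  | zero => exact H x
  | succ q ih =>
    exact ih (N := OmegaTensor k N) (N' := OmegaTensor k N') (P := OmegaTensor k P)
      (P' := OmegaTensor k P') (omegaRes_lTensor k ρ H) x

lemma res_insert (η : Ω[A⁄k]) (q : ℕ) {N : ModuleCat.{u} A} {N' : ModuleCat.{u} B}
    (g : N →ₛₗ[(ρ : A →+* B)] N') (x : Forms k q N) :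
    res k ρ (q + 1) g (insert k η q N x) =
      insert k (kaehlerRes k ρ η) q N' (res k ρ q g x) := by
  induction q generalizing N N' with
  | zero => rfl
  | succ q ih =>
    rw [insert_succ_apply, insert_succ_apply, _root_.map_add, LinearMap.map_smulₛₗ, res_shift, res_shift]
    refine congrArg₂ (· + ·) (congrArg _ (ih (N := OmegaTensor k N) (N' := OmegaTensor k N')
      (omegaRes k ρ g) x)) ?_
    refine congrArg₂ (· • ·) (by simp) ?_
    exact res_map k ρ (q + 1) (P := OmegaTensor k N) (P' := OmegaTensor k N')
      (f := cons k η N) (f' := cons k (kaehlerRes k ρ η) N') (fun _ => rfl) x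

end Forms

variable {M M' : Type u} [AddCommGroup M] [Module k M] [Module A M] [IsScalarTower k A M]
  [AddCommGroup M'] [Module k M'] [Module B M'] [IsScalarTower k B M']

namespace Jet

/-- The map `J¹(M) → J¹(M')`, `a ⊠ m ↦ ρ a ⊠ g m`. -/
def res (g : M →ₛₗ[(ρ : A →+* B)] M') : Jet k A M →ₛₗ[(ρ : A →+* B)] Jet k B M' :=
  (jetRel k A M).liftQ
    ({ toFun := (jetRel k B M').mkQ ∘ TensorProduct.map ρ.toLinearMap
        ({ toFun := g, map_add' := map_add g, map_smul' := fun c m => by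
            rw [← algebraMap_smul A c m, LinearMap.map_smulₛₗ]
            simp } : M →ₗ[k] M')
       map_add' := fun x y => by simp
       map_smul' := fun a x => by
        induction x with
        | zero => simp
        | add x y hx hy => simp only [Function.comp_apply, map_add, smul_add] at hx hy ⊢; rw [hx, hy]
        | tmul b m =>
          simp only [Function.comp_apply, smul_tmul', map_tmul]
          rw [← map_smul, smul_tmul']
          simp } : A ⊗[k] M →ₛₗ[(ρ : A →+* B)] Jet k B M') (by
    rw [jetRel_eq, Submodule.span_le]
    rintro _ ⟨a, b, m, rfl⟩
    change (jetRel k B M').mkQ _ = 0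
    rw [map_add, map_sub, map_sub, map_tmul, map_tmul, map_tmul, map_tmul]
    simp only [AlgHom.toLinearMap_apply, LinearMap.coe_mk, AddHom.coe_mk, map_mul, map_one,
      LinearMap.map_smulₛₗ, map_add, map_sub]
    exact mk_rel k (ρ a) (ρ b) (g m))

lemma res_mk (g : M →ₛₗ[(ρ : A →+* B)] M') (a : A) (m : M) :
    res k ρ g (mk k a m) = mk k (ρ a) (g m) := rfl

lemma mul_res (g : M →ₛₗ[(ρ : A →+* B)] M') (x : Jet k A M) :
    g (mul k A M x) = mul k B M' (res k ρ g x) := by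
  induction x using Jet.induction with
  | h0 => simp only [map_zero]
  | h1 a m => rw [res_mk, mul_mk, mul_mk, LinearMap.map_smulₛₗ]; rfl
  | h2 x y hx hy => simp only [map_add, hx, hy]

lemma incl_res (g : M →ₛₗ[(ρ : A →+* B)] M') (x : Ω[A⁄k] ⊗[A] M) :
    res k ρ g (incl k A M x) = incl k B M' (omegaRes k ρ g x) := by
  induction x with
  | zero => simp only [map_zero]
  | add x y hx hy => simp only [map_add, hx, hy]
  | tmul ω m =>
    have hω : ω ∈ Submodule.span A (Set.range (KaehlerDifferential.D k A)) := by
      rw [KaehlerDifferential.span_range_derivation]; trivial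
    induction hω using Submodule.span_induction with
    | mem x hx =>
      obtain ⟨a, rfl⟩ := hx
      rw [incl_tmul, omegaRes_tmul, kaehlerRes_D, incl_tmul, map_sub, res_mk, res_mk, map_one,
        LinearMap.map_smulₛₗ]
      rfl
    | zero => simp only [zero_tmul, map_zero]
    | add x y _ _ hx hy => simp only [add_tmul, map_add, hx, hy]
    | smul c x _ hx => rw [← smul_tmul', map_smul, LinearMap.map_smulₛₗ, LinearMap.map_smulₛₗ,
        map_smul, hx]

lemma map_res {N N' : Type u} [AddCommGroup N] [Module k N] [Module A N] [IsScalarTower k A N]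
    [AddCommGroup N'] [Module k N'] [Module B N'] [IsScalarTower k B N']
    {g : M →ₛₗ[(ρ : A →+* B)] M'} {h : N →ₛₗ[(ρ : A →+* B)] N'}
    {f : M →ₗ[A] N} {f' : M' →ₗ[B] N'} (H : ∀ x, h (f x) = f' (g x)) (x : Jet k A M) :
    res k ρ h (map k f x) = map k f' (res k ρ g x) := by
  induction x using Jet.induction with
  | h0 => simp only [map_zero]
  | h1 a m => rw [map_mk, res_mk, res_mk, map_mk, H]
  | h2 x y hx hy => simp only [map_add, hx, hy]

end Jet

namespace Coeff

/-- The map of coefficient modules induced by a `ρ`-semilinear map `M → M'`. -/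
def res (g : M →ₛₗ[(ρ : A →+* B)] M') : ∀ n q : ℕ,
    Coeff k A M n q →ₛₗ[(ρ : A →+* B)] Coeff k B M' n q
  | 0, 0 => g
  | 0, _ + 1 => 0
  | _ + 1, 0 => Jet.res k ρ g
  | n + 1, q + 1 => res g n q

variable (g : M →ₛₗ[(ρ : A →+* B)] M')

lemma proj_res : ∀ (n q : ℕ) (x : Coeff k A M n q),
    res k ρ g n (q + 1) (proj k A M n q x) = proj k B M' n q (res k ρ g n q x)
  | 0, _, _ => map_zero _
  | 1, 0, x => Jet.mul_res k ρ g x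
  | _ + 2, 0, _ => rfl
  | 1, q + 1, x => proj_res 0 q x
  | n + 2, q + 1, x => proj_res (n + 1) q x

lemma lower_res : ∀ (n q : ℕ) (x : OmegaTensor k (Coeff k A M n (q + 1))),
    res k ρ g n q (lower k A M n q x) = lower k B M' n q (omegaRes k ρ (res k ρ g n (q + 1)) x)
  | 0, _, _ => map_zero _
  | 1, 0, x => Jet.incl_res k ρ g x
  | _ + 2, 0, x => (Jet.incl_res k ρ g _).trans (congrArg (Jet.incl k B M')
      (omegaRes_lTensor k ρ (Jet.mul_res k ρ g) x))
  | 1, q + 1, x => lower_res 0 q x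
  | n + 2, q + 1, x => lower_res (n + 1) q x

lemma map_res {N N' : Type u} [AddCommGroup N] [Module k N] [Module A N] [IsScalarTower k A N]
    [AddCommGroup N'] [Module k N'] [Module B N'] [IsScalarTower k B N']
    {g : M →ₛₗ[(ρ : A →+* B)] M'} {h : N →ₛₗ[(ρ : A →+* B)] N'}
    {f : M →ₗ[A] N} {f' : M' →ₗ[B] N'} (H : ∀ x, h (f x) = f' (g x)) :
    ∀ (n q : ℕ) (x : Coeff k A M n q),
    res k ρ h n q (map k f n q x) = map k f' n q (res k ρ g n q x)
  | 0, 0, x => H x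
  | 0, _ + 1, _ => rfl
  | _ + 1, 0, x => Jet.map_res k ρ H x
  | n + 1, q + 1, x => map_res H n q x

end Coeff

namespace At

variable (n : ℕ)

/-- The map `At(M) → At(M')` induced by a `ρ`-semilinear map `M → M'`. -/
def res (g : M →ₛₗ[(ρ : A →+* B)] M') : At k A M n →ₛₗ[(ρ : A →+* B)] At k B M' n where
  toFun x q := Forms.res k ρ q (Coeff.res k ρ g n q) (x q)
  map_add' x y := funext fun q => map_add (Forms.res k ρ q (Coeff.res k ρ g n q)) (x q) (y q)
  map_smul' a x := funext fun q =>
    LinearMap.map_smulₛₗ (Forms.res k ρ q (Coeff.res k ρ g n q)) a (x q)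

variable (g : M →ₛₗ[(ρ : A →+* B)] M')

lemma gamma_res (x : At k A M n) :
    res k ρ n g (gamma k A M n x) = gamma k B M' n (res k ρ n g x) := by
  funext q
  refine (LinearMap.map_smulₛₗ (Forms.res k ρ q (Coeff.res k ρ g n q)) _ (x q)).trans ?_
  refine congrArg₂ (· • ·) (by simp) rfl

lemma m_res (x : At k A M n) : res k ρ n g (m k A M n x) = m k B M' n (res k ρ n g x) :=
  funext fun q => Forms.res_map k ρ q (N := OmegaTensor k (Coeff k A M n (q + 1)))
    (N' := OmegaTensor k (Coeff k B M' n (q + 1))) (Coeff.lower_res k ρ g n q) (x (q + 1))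

lemma B_res (η : Ω[A⁄k]) (x : At k A M n) :
    res k ρ n g (At.B k M n η x) = At.B k M' n (kaehlerRes k ρ η) (res k ρ n g x) := by
  funext q
  cases q with
  | zero => exact map_zero (Forms.res k ρ 0 (Coeff.res k ρ g n 0))
  | succ q =>
    exact (Forms.res_map k ρ (q + 1) (Coeff.proj_res k ρ g n q) _).trans
      (congrArg _ (Forms.res_insert k ρ η q _ _))

lemma map_res {N N' : Type u} [AddCommGroup N] [Module k N] [Module A N] [IsScalarTower k A N]
    [AddCommGroup N'] [Module k N'] [Module B N'] [IsScalarTower k B N']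
    {g : M →ₛₗ[(ρ : A →+* B)] M'} {h : N →ₛₗ[(ρ : A →+* B)] N'}
    {f : M →ₗ[A] N} {f' : M' →ₗ[B] N'} (H : ∀ x, h (f x) = f' (g x)) (x : At k A M n) :
    res k ρ n h (map k n f x) = map k n f' (res k ρ n g x) :=
  funext fun q => Forms.res_map k ρ q (Coeff.map_res k ρ H n q) (x q)

lemma d_res (w : A) (e : M →ₗ[A] M) (e' : M' →ₗ[B] M') (H : ∀ x, g (e x) = e' (g x))
    (x : At k A M n) : res k ρ n g (d k n w e x) = d k n (ρ w) e' (res k ρ n g x) := by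
  have h1 (y : At k A M n) : d k n w e y = At.B k M n (KaehlerDifferential.D k A w) y -
    m k A M n (gamma k A M n y) + map k n e (gamma k A M n y) := rfl
  have h2 (y : At k B M' n) : d k n (ρ w) e' y = At.B k M' n (KaehlerDifferential.D k B (ρ w)) y -
    m k B M' n (gamma k B M' n y) + map k n e' (gamma k B M' n y) := rfl
  rw [h1, h2, map_add, map_sub, B_res, m_res, gamma_res, kaehlerRes_D, map_res k ρ n H, gamma_res]

end At

end BaseChange

section Formula

variable (k : Type u) [CommRing k] {A : Type u} [CommRing A] [Algebra k A]

section

variable {M : Type u} [AddCommGroup M] [Module A M]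

/-- The composition `ψ₁ ψ₂ ⋯ ψ_l : M → Ω^{⊗ l} ⊗ M` of maps `ψ_i : M → Ω ⊗ M`. The last map is
applied first, and every map is applied to the tensor factor `M`. -/
def word : ∀ L : List (M →ₗ[A] Ω[A⁄k] ⊗[A] M), M →ₗ[A] Forms k L.length (ModuleCat.of A M)
  | [] => LinearMap.id
  | ψ :: L => (Forms.shift k L.length (ModuleCat.of A M)).toLinearMap ∘ₗ
      Forms.map k L.length (N := ModuleCat.of A M) (N' := OmegaTensor k (ModuleCat.of A M)) ψ ∘ₗ
      word L

/-- The sequence `[∇₀, e] ^ κ₀ (∇₀ - ∇₁) [∇₁, e] ^ κ₁ (∇₁ - ∇₂) ⋯ [∇_p, e] ^ κ_p`. -/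
def letters (e : M →ₗ[A] M) : ∀ p : ℕ, (Fin (p + 1) → Connection k A M) → (Fin (p + 1) → ℕ) →
    List (M →ₗ[A] Ω[A⁄k] ⊗[A] M)
  | 0, c, κ => List.replicate (κ 0) ((c 0).bracket e)
  | p + 1, c, κ => List.replicate (κ 0) ((c 0).bracket e) ++
      (c 0).diff (c 1) :: letters e p (Fin.tail c) (Fin.tail κ)

end

variable {M : Type u} [AddCommGroup M] [Module k M] [Module A M] [IsScalarTower k A M]

/-- The map `Ω^{⊗ q} ⊗ M → At(M)` induced by the splitting `M → J¹(M)` of a connection if `q < n`;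
it is the inclusion of the summand `Ω^{⊗ n} ⊗ M` if `q = n`, and zero if `q > n`. -/
def sigma (c : Connection k A M) (n q : ℕ) :
    Forms k q (ModuleCat.of A M) →ₗ[A] At k A M n :=
  LinearMap.single A (fun q => Forms k q (Coeff k A M n q)) q ∘ₗ
    Forms.map k q (N := ModuleCat.of A M) (Coeff.split k c n q)

/-- The map
`σ₀ ∑_κ (-1) ^ (∑_j j (κ_j + 1)) [∇₀, e] ^ κ₀ (∇₀ - ∇₁) [∇₁, e] ^ κ₁ ⋯ [∇_p, e] ^ κ_p`. Words of
length greater than `n` do not contribute, so it suffices to sum over `κ_j ≤ n`. -/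
def formula (e : M →ₗ[A] M) (n p : ℕ) (c : Fin (p + 1) → Connection k A M) :
    M →ₗ[A] At k A M n :=
  ∑ κ : Fin (p + 1) → Fin (n + 1),
    (-1 : A) ^ (∑ j : Fin (p + 1), (j : ℕ) * ((κ j : ℕ) + 1)) •
      (sigma k (c 0) n (letters k e p c fun j => κ j).length ∘ₗ
        word k (letters k e p c fun j => κ j))

end Formula

section Parity

variable (A : Type u) [CommRing A] (M₀ M₁ : Type u) [AddCommGroup M₀] [Module A M₀]
  [AddCommGroup M₁] [Module A M₁]

/-- The projection of `M₀ ⊕ M₁` to the summand of degree `b`. -/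
def parityProj (b : ZMod 2) : M₀ × M₁ →ₗ[A] M₀ × M₁ :=
  if b = 0 then LinearMap.inl A M₀ M₁ ∘ₗ LinearMap.fst A M₀ M₁
  else LinearMap.inr A M₀ M₁ ∘ₗ LinearMap.snd A M₀ M₁

end Parity

section Geometry

variable (k : Type u) [Field k] {X : Scheme.{u}} [X.Over (Spec (.of k))]

instance (U : X.Opens) : Algebra k Γ(X, U) :=
  ((X.presheaf.map (homOfLE le_top).op).hom.comp
    (((X ↘ Spec (.of k)).appTop).hom.comp (Scheme.ΓSpecIso (.of k)).inv.hom)).toAlgebra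

instance (M : X.Modules) (U : X.Opens) : Module k Γ(M, U) :=
  Module.compHom _ (algebraMap k Γ(X, U))

instance (M : X.Modules) (U : X.Opens) : IsScalarTower k Γ(X, U) Γ(M, U) :=
  .of_algebraMap_smul fun _ _ => rfl

/-- Restriction of functions. -/
def funRes {V W : X.Opens} (h : W ≤ V) : Γ(X, V) →ₐ[k] Γ(X, W) where
  toRingHom := (X.presheaf.map (homOfLE h).op).hom
  commutes' c := by
    change X.presheaf.map (homOfLE h).op (X.presheaf.map (homOfLE le_top).op _) =
      X.presheaf.map (homOfLE le_top).op _
    rw [← CommRingCat.comp_apply, ← Functor.map_comp]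
    rfl

lemma funRes_comp {V W Z : X.Opens} (h : W ≤ V) (h' : Z ≤ W) (a : Γ(X, V)) :
    funRes k h' (funRes k h a) = funRes k (h'.trans h) a := by
  change X.presheaf.map (homOfLE h').op (X.presheaf.map (homOfLE h).op _) =
      X.presheaf.map (homOfLE _).op _
  rw [← CommRingCat.comp_apply, ← Functor.map_comp]
  rfl

/-- Restriction of sections. -/
def secRes (M : X.Modules) {V W : X.Opens} (h : W ≤ V) :
    Γ(M, V) →ₛₗ[(funRes k h : Γ(X, V) →+* Γ(X, W))] Γ(M, W) where
  toFun := M.presheaf.map (homOfLE h).op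
  map_add' := map_add _
  map_smul' := Scheme.Modules.map_smul M (homOfLE h)

/-- The affine open subsets of `V ∩ U`. -/
abbrev AffineIn (U V : X.Opens) : Type u :=
  {W : X.Opens // IsAffineOpen W ∧ W ≤ V ∧ W ≤ U}

/-- A vector bundle: a locally free sheaf of finite type. -/
def IsVectorBundle (M : X.Modules) : Prop :=
  SheafOfModules.IsLocallyFree (R := X.ringCatSheaf) M ∧
    SheafOfModules.IsFiniteType (R := X.ringCatSheaf) M

/-- A matrix factorization of `w`: vector bundles `E₀` and `E₁` with maps `e₀ : E₀ → E₁` and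
`e₁ : E₁ → E₀` whose two compositions are multiplication by `w`. -/
structure MatrixFactorization (X : Scheme.{u}) (w : Γ(X, ⊤)) where
  E₀ : X.Modules
  E₁ : X.Modules
  isVectorBundle₀ : IsVectorBundle E₀
  isVectorBundle₁ : IsVectorBundle E₁
  e₀ : E₀ ⟶ E₁
  e₁ : E₁ ⟶ E₀
  e₁_e₀ : ∀ (V : X.Opens) (s : Γ(E₀, V)),
    e₁.app V (e₀.app V s) = X.presheaf.map (homOfLE (le_top : V ≤ ⊤)).op w • s
  e₀_e₁ : ∀ (V : X.Opens) (s : Γ(E₁, V)),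
    e₀.app V (e₁.app V s) = X.presheaf.map (homOfLE (le_top : V ≤ ⊤)).op w • s

variable {w : Γ(X, ⊤)} (E : MatrixFactorization X w)

namespace MatrixFactorization

/-- The sections of `E₀ ⊕ E₁` over `V`. -/
abbrev Sec (V : X.Opens) : Type u := Γ(E.E₀, V) × Γ(E.E₁, V)

/-- The curved differential `(s₀, s₁) ↦ (e₁ s₁, e₀ s₀)`. -/
def e (V : X.Opens) : E.Sec V →ₗ[Γ(X, V)] E.Sec V where
  toFun s := (E.e₁.app V s.2, E.e₀.app V s.1)
  map_add' s t := Prod.ext (map_add (E.e₁.app V).hom s.2 t.2) (map_add (E.e₀.app V).hom s.1 t.1)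
  map_smul' a s := Prod.ext (E.e₁.app_smul a s.2) (E.e₀.app_smul a s.1)

/-- Restriction of sections of `E₀ ⊕ E₁`. -/
def res {V W : X.Opens} (h : W ≤ V) :
    E.Sec V →ₛₗ[(funRes k h : Γ(X, V) →+* Γ(X, W))] E.Sec W where
  toFun s := (secRes k E.E₀ h s.1, secRes k E.E₁ h s.2)
  map_add' _ _ := Prod.ext (map_add (secRes k E.E₀ h) _ _) (map_add (secRes k E.E₁ h) _ _)
  map_smul' a s := Prod.ext (LinearMap.map_smulₛₗ (secRes k E.E₀ h) a s.1)
    (LinearMap.map_smulₛₗ (secRes k E.E₁ h) a s.2)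

lemma res_e {V W : X.Opens} (h : W ≤ V) (s : E.Sec V) :
    E.res k h (E.e V s) = E.e W (E.res k h s) :=
  Prod.ext (ConcreteCategory.congr_hom (E.e₁.mapPresheaf.naturality (homOfLE h).op) s.2).symm
    (ConcreteCategory.congr_hom (E.e₀.mapPresheaf.naturality (homOfLE h).op) s.1).symm

/-- The sections of `E₀ ⊕ E₁` over `V` of degree `b`. -/
def HasDegree {V : X.Opens} (s : E.Sec V) (b : ZMod 2) : Prop :=
  parityProj Γ(X, V) Γ(E.E₀, V) Γ(E.E₁, V) b s = s

/-- A connection over the open subset `U` on the graded bundle `E₀ ⊕ E₁`, preserving the grading: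
compatible connections on the modules of sections over the affine open subsets of `U`. -/
structure LocalConnection (U : X.Opens) where
  conn₀ : ∀ W : X.Opens, IsAffineOpen W → W ≤ U → Connection k Γ(X, W) Γ(E.E₀, W)
  conn₁ : ∀ W : X.Opens, IsAffineOpen W → W ≤ U → Connection k Γ(X, W) Γ(E.E₁, W)
  compat₀ : ∀ (W W' : X.Opens) (hW : IsAffineOpen W) (hW' : IsAffineOpen W') (hU : W ≤ U)
    (h : W' ≤ W) (s : Γ(E.E₀, W)), (conn₀ W' hW' (h.trans hU)).toFun (secRes k E.E₀ h s) =
      omegaRes k (funRes k h) (secRes k E.E₀ h) ((conn₀ W hW hU).toFun s)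
  compat₁ : ∀ (W W' : X.Opens) (hW : IsAffineOpen W) (hW' : IsAffineOpen W') (hU : W ≤ U)
    (h : W' ≤ W) (s : Γ(E.E₁, W)), (conn₁ W' hW' (h.trans hU)).toFun (secRes k E.E₁ h s) =
      omegaRes k (funRes k h) (secRes k E.E₁ h) ((conn₁ W hW hU).toFun s)

/-- The connection on the sections of `E₀ ⊕ E₁` over an affine open subset. -/
def LocalConnection.at {E : MatrixFactorization X w} {U : X.Opens} (c : E.LocalConnection k U)
    (W : X.Opens) (hW : IsAffineOpen W) (h : W ≤ U) : Connection k Γ(X, W) (E.Sec W) :=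
  (c.conn₀ W hW h).prod (c.conn₁ W hW h)

variable (n : ℕ)

/-- The sections over an affine open subset `W` of the sheaf
`At(E) = ⨁_{q < n} Ω^{⊗ q} ⊗ J¹(E) ⊕ Ω^{⊗ n} ⊗ E`, where `n` is usually the dimension of `X`. -/
abbrev AtSec (W : X.Opens) : Type u := At k Γ(X, W) (E.Sec W) n

/-- Restriction of sections of `At(E)` between affine open subsets. -/
def atRes {V W : X.Opens} (h : W ≤ V) :
    E.AtSec k n V →ₛₗ[(funRes k h : Γ(X, V) →+* Γ(X, W))] E.AtSec k n W :=
  At.res k (funRes k h) n (E.res k h)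

/-- The differential of `At(E)` over an affine open subset. -/
def atD (W : X.Opens) : E.AtSec k n W →ₗ[Γ(X, W)] E.AtSec k n W :=
  At.d k n (funRes k le_top w) (E.e W)

lemma atRes_atD {V W : X.Opens} (h : W ≤ V) (x : E.AtSec k n V) :
    E.atRes k n h (E.atD k n V x) = E.atD k n W (E.atRes k n h x) := by
  refine (At.d_res k (funRes k h) n (E.res k h) _ _ (E.e W) (E.res_e k h) x).trans ?_
  rw [funRes_comp]
  rfl

/-- An element of `Ω^{⊗ q} ⊗ J¹(E_i)`, or of `Ω^{⊗ n} ⊗ E_i` if `q = n`, has degree `i + q`. -/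
def AtHasDegree {W : X.Opens} (x : E.AtSec k n W) (b : ZMod 2) : Prop :=
  ∀ q : ℕ, Forms.map k q (Coeff.map k
    (parityProj Γ(X, W) Γ(E.E₀, W) Γ(E.E₁, W) (b + q)) n q) (x q) = x q

/-- The sections over `V` of `j_* (At(E)|_U)`, where `j : U → X` is the inclusion: compatible
families of sections of `At(E)` over the affine open subsets of `V ∩ U`. -/
def AtOver (U V : X.Opens) : AddSubgroup (∀ W : AffineIn U V, E.AtSec k n W.1) where
  carrier := {x | ∀ (W W' : AffineIn U V) (h : W'.1 ≤ W.1), E.atRes k n h (x W) = x W'}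
  add_mem' hx hy W W' h := (map_add (E.atRes k n h) _ _).trans
    (congrArg₂ (· + ·) (hx W W' h) (hy W W' h))
  zero_mem' _ _ h := map_zero (E.atRes k n h)
  neg_mem' hx W W' h := (map_neg (E.atRes k n h) _).trans (congrArg Neg.neg (hx W W' h))

namespace AtOver

variable {E n k} {U V : X.Opens}

lemma ext {x y : E.AtOver k n U V} (H : ∀ W, x.1 W = y.1 W) : x = y :=
  Subtype.ext (funext H)

instance : SMul Γ(X, V) (E.AtOver k n U V) where
  smul a x := ⟨fun W => funRes k W.2.2.1 a • x.1 W, fun W W' h =>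
    (LinearMap.map_smulₛₗ (E.atRes k n h) _ _).trans
      (congrArg₂ (· • ·) (funRes_comp k W.2.2.1 h a) (x.2 W W' h))⟩

instance : Module Γ(X, V) (E.AtOver k n U V) where
  one_smul x := ext fun W => by
    change funRes k W.2.2.1 1 • x.1 W = _
    rw [map_one, one_smul]
  mul_smul a b x := ext fun W => by
    change funRes k W.2.2.1 (a * b) • x.1 W = funRes k W.2.2.1 a • funRes k W.2.2.1 b • x.1 W
    rw [map_mul, mul_smul]
  smul_zero a := ext fun W => smul_zero (funRes k W.2.2.1 a)
  smul_add a x y := ext fun W => smul_add (funRes k W.2.2.1 a) _ _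
  add_smul a b x := ext fun W => by
    change funRes k W.2.2.1 (a + b) • x.1 W = _
    rw [map_add, add_smul]
    rfl
  zero_smul x := ext fun W => by
    change funRes k W.2.2.1 0 • x.1 W = _
    rw [map_zero, zero_smul]
    rfl

/-- The differential. -/
def d (x : E.AtOver k n U V) : E.AtOver k n U V :=
  ⟨fun W => E.atD k n W.1 (x.1 W), fun W W' h =>
    (E.atRes_atD k n h _).trans (congrArg _ (x.2 W W' h))⟩

/-- Restriction of sections from `V` to a smaller open subset `V'`. -/
def res {V' : X.Opens} (h : V' ≤ V) (x : E.AtOver k n U V) : E.AtOver k n U V' :=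
  ⟨fun W => x.1 ⟨W.1, W.2.1, W.2.2.1.trans h, W.2.2.2⟩, fun W W' h' =>
    x.2 ⟨W.1, W.2.1, W.2.2.1.trans h, W.2.2.2⟩ ⟨W'.1, W'.2.1, W'.2.2.1.trans h, W'.2.2.2⟩ h'⟩

/-- The restriction `j_* (At(E)|_U) → j'_* (At(E)|_{U'})` to a smaller open subset `U'`. -/
def restrict {U' : X.Opens} (h : U' ≤ U) (x : E.AtOver k n U V) : E.AtOver k n U' V :=
  ⟨fun W => x.1 ⟨W.1, W.2.1, W.2.2.1, W.2.2.2.trans h⟩, fun W W' h' =>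
    x.2 ⟨W.1, W.2.1, W.2.2.1, W.2.2.2.trans h⟩ ⟨W'.1, W'.2.1, W'.2.2.1, W'.2.2.2.trans h⟩ h'⟩

/-- The sections of degree `b`. -/
def HasDegree (x : E.AtOver k n U V) (b : ZMod 2) : Prop :=
  ∀ W, E.AtHasDegree k n (x.1 W) b

end AtOver

/-- A morphism of `𝒪`-modules `E → j_* (At(E)|_U)`. -/
structure AtHom (U : X.Opens) where
  app : ∀ V : X.Opens, E.Sec V →ₗ[Γ(X, V)] E.AtOver k n U V
  naturality : ∀ (V V' : X.Opens) (h : V' ≤ V) (s : E.Sec V),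
    app V' (E.res k h s) = AtOver.res h (app V s)

variable {N : ℕ} (U : Fin N → X.Opens)

/-- The intersection `U_{i_0} ∩ ⋯ ∩ U_{i_p}`. -/
abbrev inter {p : ℕ} (i : Fin (p + 1) ↪o Fin N) : X.Opens := ⨅ a, U (i a)

lemma inter_le_face {p : ℕ} (i : Fin (p + 2) ↪o Fin N) (j : Fin (p + 2)) :
    inter U i ≤ inter U ((Fin.succAboveOrderEmb j).trans i) :=
  le_iInf fun a => iInf_le (fun b => U (i b)) (j.succAbove a)

/-- The sections over `V` of the Čech complex of `At(E)`, the direct sum of all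
`j_* (At(E)|_{U_{i_0} ∩ ⋯ ∩ U_{i_p}})` for `i_0 < ⋯ < i_p`. -/
abbrev Cech (V : X.Opens) : Type u :=
  ∀ (p : ℕ) (i : Fin (p + 1) ↪o Fin N), E.AtOver k n (inter U i) V

namespace Cech

variable {E k n U} {V : X.Opens}

/-- The Čech differential
`(c x)_{i_0 … i_p} = ∑_j (-1) ^ j x_{i_0 … î_j … i_p} |_{U_{i_0} ∩ ⋯ ∩ U_{i_p}}`, which is zero if
`p = 0`. -/
def c (x : E.Cech k n U V) : E.Cech k n U V
  | 0, _ => 0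
  | p + 1, i => ∑ j : Fin (p + 2), (-1 : ℤ) ^ (j : ℕ) •
      AtOver.restrict (inter_le_face U i j) (x p ((Fin.succAboveOrderEmb j).trans i))

/-- The total differential `c + γ d`, where `γ` is `(-1) ^ p` on the components `i_0 … i_p` and `d`
is the differential of `At(E)`. -/
def d (x : E.Cech k n U V) : E.Cech k n U V :=
  c x + fun p i => (-1 : ℤ) ^ p • AtOver.d (x p i)

/-- The degree of an element of the component `i_0 … i_p` is its degree in `At(E)` plus `p`. -/
def HasDegree (x : E.Cech k n U V) (b : ZMod 2) : Prop :=
  ∀ (p : ℕ) (i : Fin (p + 1) ↪o Fin N), AtOver.HasDegree (x p i) (b + p)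

/-- Restriction of sections to a smaller open subset. -/
def res {V' : X.Opens} (h : V' ≤ V) (x : E.Cech k n U V) : E.Cech k n U V' :=
  fun p i => AtOver.res h (x p i)

end Cech

/-- A morphism of `𝒪`-modules from `E` to the Čech complex of `At(E)`. -/
structure CechHom where
  app : ∀ V : X.Opens, E.Sec V →ₗ[Γ(X, V)] E.Cech k n U V
  naturality : ∀ (V V' : X.Opens) (h : V' ≤ V) (s : E.Sec V),
    app V' (E.res k h s) = Cech.res h (app V s)

namespace CechHom

variable {E k n U}

/-- Morphisms of degree zero. -/
def IsDegreeZero (f : E.CechHom k n U) : Prop :=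
  ∀ (V : X.Opens) (b : ZMod 2) (s : E.Sec V), E.HasDegree s b → Cech.HasDegree (f.app V s) b

/-- Closed morphisms of degree zero, that is morphisms that commute with the differentials. -/
def IsClosed (f : E.CechHom k n U) : Prop :=
  ∀ (V : X.Opens) (s : E.Sec V), Cech.d (f.app V s) = f.app V (E.e V s)

/-- The morphism `∑_p ∑_{i_0 < ⋯ < i_p} (-1) ^ (p (p - 1) / 2) f_{i_0 … i_p}`. -/
def assemble (f : ∀ (p : ℕ) (i : Fin (p + 1) ↪o Fin N), E.AtHom k n (inter U i)) :
    E.CechHom k n U where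
  app V := LinearMap.pi fun p => LinearMap.pi fun i => (-1 : Γ(X, V)) ^ (p * (p - 1) / 2) •
    (f p i).app V
  naturality V V' h s := by
    funext p i
    refine AtOver.ext fun W => ?_
    change funRes k W.2.2.1 ((-1) ^ (p * (p - 1) / 2)) • ((f p i).app V' (E.res k h s)).1 W =
      funRes k _ ((-1) ^ (p * (p - 1) / 2)) • (AtOver.res h ((f p i).app V s)).1 W
    rw [(f p i).naturality]
    simp only [map_pow, map_neg, map_one]

end CechHom

/-- The collection of morphisms `f_{i_0 … i_p} : E → j_* (At(E)|_{U_{i_0} ∩ ⋯ ∩ U_{i_p}})` is given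
by the local formula. -/
def IsGivenByFormula (c : ∀ j, E.LocalConnection k (U j))
    (f : ∀ (p : ℕ) (i : Fin (p + 1) ↪o Fin N), E.AtHom k n (inter U i)) : Prop :=
  ∀ (p : ℕ) (i : Fin (p + 1) ↪o Fin N) (V : X.Opens) (s : E.Sec V)
    (W : AffineIn (inter U i) V), ((f p i).app V s).1 W = formula k (E.e W.1) n p
      (fun a => (c (i a)).at k W.1 W.2.1 (W.2.2.2.trans (iInf_le (fun a => U (i a)) a)))
      (E.res k W.2.2.1 s)

end MatrixFactorization

end Geometry

end MatFact

end

/-!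
Over an affine open set, with sections `A` of the structure sheaf and `M` of the bundle, write
`f_{i_0 … i_p} = σ_{i_0} F`, where `F` is the signed sum of words in the letters `β_j = [∇_j, e]`
and `δ_{j, j+1} = ∇_j - ∇_{j+1}`. Two separate cancellations make the boundary formula work.

The first concerns `F` alone. On `Ω^{⊗ l} ⊗ M` consider the curved differential
`D y = dw y + (-1) ^ l e y`, where `dw` is inserted in all positions with alternating signs. The
letters satisfy `β e + e β = dw` (as `e ^ 2 = w`), `e δ_{01} = δ_{01} e - β_0 + β_1` and
`δ_{01} + δ_{12} = δ_{02}`. Splitting off the leftmost letter gives the recursion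
`F_{l+1} = β_0 F_l + (-1) ^ (l + 1) δ_{01} F'_l` for the part of word length `l + 1`, where `F'`
belongs to `∇_1, …, ∇_p`. The alternating sum of the faces of `F` obeys a similar recursion
(`cocycleFaces_succ_succ`), and induction on `l` shows that `D F - (-1) ^ p F e` is this
alternating sum (`cocycle_boundary`); all faces occur here without their splittings.

The second concerns the splitting. Insertion of `dw` commutes with `σ`, the map `m` undoes the
leftmost letter, and `e σ_0 = σ_0 e - ι β_0` with `ι` the inclusion `Ω ⊗ M → J¹(M)`. Hence the words
starting with `β_0` cancel, and the words starting with `δ_{01}` contribute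
`-ι δ_{01} F' = (σ_1 - σ_0) F'` (`d_formula_apply`, `d_formula_succ`). This replaces `σ_0` by `σ_1`
in the face omitting `∇_0`, the only face whose leading connection is not `∇_0`. As `σ` vanishes on
words longer than `n`, sums over bounded exponents can be replaced by the recursively defined `F`
(`truncatedSum_apply_of_le`, `formula_apply`).

All ingredients commute with restriction (`formula_res`), so the local maps glue to morphisms of
sheaves (`formulaHom`). Counting the odd letters gives their degrees, and the signs
`(-1) ^ (p (p - 1) / 2)` turn the boundary formulas into the closedness of the sum.
-/

noncomputable section

namespace MatFact

/-! ### Forms with values in a module, and letters acting on them -/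

section Algebra

variable (k : Type u) [CommRing k] {A : Type u} [CommRing A] [Algebra k A]

namespace Forms

lemma map_succ_apply (q : ℕ) {N N' : ModuleCat.{u} A} (f : N →ₗ[A] N') (x : Forms k (q + 1) N) :
    map k (q + 1) f x = shift k q N' (map k q (N := OmegaTensor k N) (N' := OmegaTensor k N')
      (f.lTensor Ω[A⁄k]) ((shift k q N).symm x)) := rfl

lemma map_map (q : ℕ) {N N' N'' : ModuleCat.{u} A} (g : N' →ₗ[A] N'') (f : N →ₗ[A] N')
    (x : Forms k q N) : map k q g (map k q f x) = map k q (g ∘ₗ f) x := by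
  induction q generalizing N N' N'' with
  | zero => rfl
  | succ q ih =>
    rw [map_succ_apply, map_succ_apply, map_succ_apply, LinearMap.lTensor_comp]
    exact ih (N := OmegaTensor k N) (N' := OmegaTensor k N') (N'' := OmegaTensor k N'') _ _ x

lemma map_add_left (q : ℕ) {N N' : ModuleCat.{u} A} (f g : N →ₗ[A] N') (x : Forms k q N) :
    map k q (f + g) x = map k q f x + map k q g x := by
  induction q generalizing N N' with
  | zero => rfl
  | succ q ih =>
    rw [map_succ_apply, LinearMap.lTensor_add]
    exact ih (N := OmegaTensor k N) (N' := OmegaTensor k N') _ _ x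

lemma map_sub_left (q : ℕ) {N N' : ModuleCat.{u} A} (f g : N →ₗ[A] N') (x : Forms k q N) :
    map k q (f - g) x = map k q f x - map k q g x := by
  rw [eq_sub_iff_add_eq, ← map_add_left, sub_add_cancel]

lemma map_zero_left (q : ℕ) {N N' : ModuleCat.{u} A} (x : Forms k q N) :
    map k q (0 : N →ₗ[A] N') x = 0 := by
  have h := map_sub_left k q (0 : N →ₗ[A] N') 0 x
  rwa [sub_self, sub_self] at h

lemma insert_map (η : Ω[A⁄k]) (q : ℕ) {N N' : ModuleCat.{u} A} (f : N →ₗ[A] N')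
    (x : Forms k q N) :
    insert k η q N' (map k q f x) = map k (q + 1) f (insert k η q N x) := by
  induction q generalizing N N' with
  | zero => rfl
  | succ q ih =>
    rw [insert_succ_apply, insert_succ_apply, map_add, map_smul]
    refine congrArg₂ (· + ·) (ih (N := OmegaTensor k N) (N' := OmegaTensor k N') _ x)
      (congrArg _ ?_)
    -- both sides apply `cons η ∘ f = (1 ⊗ f) ∘ cons η` to the last factor
    exact (map_map k (q + 1) (N'' := OmegaTensor k N') (cons k η N') f x).trans
      (map_map k (q + 1) (N' := OmegaTensor k N) (N'' := OmegaTensor k N')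
        (f.lTensor Ω[A⁄k]) (cons k η N) x).symm

end Forms

section Put

variable {M : Type u} [AddCommGroup M] [Module A M]

/-- The map `Ω^{⊗ l} ⊗ M → Ω^{⊗ (l + 1)} ⊗ M` applying `ψ : M → Ω ⊗ M` to the tensor factor `M`. -/
def put (ψ : M →ₗ[A] Ω[A⁄k] ⊗[A] M) (l : ℕ) :
    Forms k l (ModuleCat.of A M) →ₗ[A] Forms k (l + 1) (ModuleCat.of A M) :=
  (Forms.shift k l (ModuleCat.of A M)).toLinearMap ∘ₗ
    Forms.map k l (N := ModuleCat.of A M) (N' := OmegaTensor k (ModuleCat.of A M)) ψ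

/-- The endomorphism `1 ⊗ e` of `Ω^{⊗ l} ⊗ M`. -/
abbrev act (e : M →ₗ[A] M) (l : ℕ) :
    Forms k l (ModuleCat.of A M) →ₗ[A] Forms k l (ModuleCat.of A M) :=
  Forms.map k l (N := ModuleCat.of A M) (N' := ModuleCat.of A M) e

variable (ψ ψ' : M →ₗ[A] Ω[A⁄k] ⊗[A] M) (l : ℕ) (y : Forms k l (ModuleCat.of A M))

lemma put_add_left : put k (ψ + ψ') l y = put k ψ l y + put k ψ' l y :=
  Forms.map_add_left k l (N := ModuleCat.of A M) (N' := OmegaTensor k (ModuleCat.of A M)) ψ ψ' y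

lemma put_sub_left : put k (ψ - ψ') l y = put k ψ l y - put k ψ' l y :=
  Forms.map_sub_left k l (N := ModuleCat.of A M) (N' := OmegaTensor k (ModuleCat.of A M)) ψ ψ' y

lemma put_act (e : M →ₗ[A] M) : put k ψ l (act k e l y) = put k (ψ ∘ₗ e) l y :=
  Forms.map_map k l (N := ModuleCat.of A M) (N' := ModuleCat.of A M)
    (N'' := OmegaTensor k (ModuleCat.of A M)) ψ e y

lemma act_put (e : M →ₗ[A] M) :
    act k e (l + 1) (put k ψ l y) = put k (e.lTensor Ω[A⁄k] ∘ₗ ψ) l y :=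
  Forms.map_map k l (N := ModuleCat.of A M) (N' := OmegaTensor k (ModuleCat.of A M))
    (N'' := OmegaTensor k (ModuleCat.of A M)) (e.lTensor Ω[A⁄k]) ψ y

lemma insert_put (η : Ω[A⁄k]) :
    Forms.insert k η (l + 1) (ModuleCat.of A M) (put k ψ l y) =
      put k ψ (l + 1) (Forms.insert k η l (ModuleCat.of A M) y) +
        (-1 : A) ^ (l + 1) • put k (Forms.cons k η (ModuleCat.of A M)) (l + 1) (put k ψ l y) := by
  rw [Forms.insert_succ_apply]
  exact congrArg₂ (· + ·) (Forms.insert_map k η l (N := ModuleCat.of A M)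
    (N' := OmegaTensor k (ModuleCat.of A M)) ψ y) rfl

end Put

/-! ### The commutation rules for the letters -/

namespace Connection

variable {k} {M : Type u} [AddCommGroup M] [Module A M]

/-- Since `e ^ 2 = w`, the graded commutator of `e` with `[∇, e]` is `dw`. -/
lemma bracket_anticomm (c : Connection k A M) {e : M →ₗ[A] M} {w : A} (he : ∀ m, e (e m) = w • m) :
    c.bracket e ∘ₗ e + e.lTensor Ω[A⁄k] ∘ₗ c.bracket e =
      Forms.cons k (KaehlerDifferential.D k A w) (ModuleCat.of A M) := by
  have h (t : Ω[A⁄k] ⊗[A] M) : e.lTensor Ω[A⁄k] (e.lTensor Ω[A⁄k] t) = w • t := by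
    rw [← LinearMap.lTensor_comp_apply, show e ∘ₗ e = w • LinearMap.id from LinearMap.ext he,
      LinearMap.lTensor_smul, LinearMap.lTensor_id]
    rfl
  ext m
  change c.toFun (e (e m)) - e.lTensor Ω[A⁄k] (c.toFun (e m)) +
    e.lTensor Ω[A⁄k] (c.toFun (e m) - e.lTensor Ω[A⁄k] (c.toFun m)) =
      KaehlerDifferential.D k A w ⊗ₜ m
  rw [map_sub, h, he, c.leibniz]
  abel

lemma bracket_sub_bracket (c c' : Connection k A M) (e : M →ₗ[A] M) :
    c.bracket e - c'.bracket e = c.diff c' ∘ₗ e - e.lTensor Ω[A⁄k] ∘ₗ c.diff c' := by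
  ext m
  change c.toFun (e m) - e.lTensor Ω[A⁄k] (c.toFun m) -
    (c'.toFun (e m) - e.lTensor Ω[A⁄k] (c'.toFun m)) =
    c.toFun (e m) - c'.toFun (e m) - e.lTensor Ω[A⁄k] (c.toFun m - c'.toFun m)
  rw [map_sub]
  abel

lemma diff_add_diff (c c' c'' : Connection k A M) : c.diff c' + c'.diff c'' = c.diff c'' := by
  ext m
  exact sub_add_sub_cancel _ _ _

end Connection

/-! ### The formula as a cocycle for the curved differential -/

section Cocycle

variable {M : Type u} [AddCommGroup M] [Module A M] (e : M →ₗ[A] M)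

/-- The part of word length `l` of
`∑_κ (-1) ^ (∑_j j (κ_j + 1)) [∇₀, e] ^ κ₀ (∇₀ - ∇₁) [∇₁, e] ^ κ₁ ⋯ [∇_p, e] ^ κ_p`, defined by
splitting off the leftmost letter. A leading `∇₀ - ∇₁` shifts the indices of the remaining
exponents by one, which changes the sign by `-1` for each of the `l` letters of the word. -/
def cocycle : ∀ (p : ℕ) (_ : Fin (p + 1) → Connection k A M) (l : ℕ),
    M →ₗ[A] Forms k l (ModuleCat.of A M)
  | 0, _, 0 => LinearMap.id
  | _ + 1, _, 0 => 0
  | 0, c, l + 1 => put k ((c 0).bracket e) l ∘ₗ cocycle 0 c l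
  | p + 1, c, l + 1 => put k ((c 0).bracket e) l ∘ₗ cocycle (p + 1) c l +
      (-1 : A) ^ (l + 1) • (put k ((c 0).diff (c 1)) l ∘ₗ cocycle p (Fin.tail c) l)

/-- The alternating sum of `cocycle` over the faces `∇₀, …, ∇̂_j, …, ∇_p`; it is zero if
`p = 0`. -/
def cocycleFaces : ∀ (p : ℕ) (_ : Fin (p + 1) → Connection k A M) (l : ℕ),
    M →ₗ[A] Forms k l (ModuleCat.of A M)
  | 0, _, _ => 0
  | p + 1, c, l => ∑ j : Fin (p + 2), (-1 : A) ^ (j : ℕ) •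
      cocycle k e p (fun a => c (j.succAbove a)) l

/-- `dw` inserted into the part of `cocycle` of word length `l - 1`; it is zero if `l = 0`. -/
def cocycleInsert (η : Ω[A⁄k]) (p : ℕ) (c : Fin (p + 1) → Connection k A M) : ∀ l : ℕ,
    M →ₗ[A] Forms k l (ModuleCat.of A M)
  | 0 => 0
  | l + 1 => Forms.insert k η l (ModuleCat.of A M) ∘ₗ cocycle k e p c l

lemma cocycle_zero_succ (c : Fin 1 → Connection k A M) (l : ℕ) (x : M) :
    cocycle k e 0 c (l + 1) x = put k ((c 0).bracket e) l (cocycle k e 0 c l x) := rfl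

lemma cocycle_succ_succ (p : ℕ) (c : Fin (p + 2) → Connection k A M) (l : ℕ) (x : M) :
    cocycle k e (p + 1) c (l + 1) x = put k ((c 0).bracket e) l (cocycle k e (p + 1) c l x) +
      (-1 : A) ^ (l + 1) • put k ((c 0).diff (c 1)) l (cocycle k e p (Fin.tail c) l x) := rfl

lemma cocycleFaces_succ (p : ℕ) (c : Fin (p + 2) → Connection k A M) (l : ℕ) (x : M) :
    cocycleFaces k e (p + 1) c l x = ∑ j : Fin (p + 2), (-1 : A) ^ (j : ℕ) •
      cocycle k e p (fun a => c (j.succAbove a)) l x := by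
  simp [cocycleFaces]

/-- The recursion for the alternating sum of the faces obtained by splitting off the leftmost
letter. The last two terms correct for the face omitting `∇₀`, which may start with `[∇₁, e]`
instead of `[∇₀, e]`. -/
lemma cocycleFaces_succ_succ (p : ℕ) (c : Fin (p + 2) → Connection k A M) (l : ℕ) (x : M) :
    cocycleFaces k e (p + 1) c (l + 1) x =
      put k ((c 0).bracket e) l (cocycleFaces k e (p + 1) c l x) +
      (-1 : A) ^ l • put k ((c 0).diff (c 1)) l (cocycleFaces k e p (Fin.tail c) l x) -
      put k ((c 0).bracket e) l (cocycle k e p (Fin.tail c) l x) +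
      put k ((c 1).bracket e) l (cocycle k e p (Fin.tail c) l x) := by
  have h0 : (fun a => c ((0 : Fin (p + 2)).succAbove a)) = Fin.tail c := by
    funext a; simp [Fin.tail]
  cases p with
  | zero =>
    rw [cocycleFaces_succ, cocycleFaces_succ, Fin.sum_univ_two, Fin.sum_univ_two, h0]
    simp only [cocycle_zero_succ, cocycleFaces, LinearMap.zero_apply, map_zero, smul_zero,
      map_add, Fin.val_zero, Fin.val_one, pow_zero, pow_one, one_smul, neg_smul,
      map_neg]
    change put k ((c 1).bracket e) l _ + -put k ((c 0).bracket e) l _ = _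
    abel
  | succ p =>
    have h1 (j : Fin (p + 2)) : Fin.tail (fun a => c (j.succ.succAbove a)) =
        fun a => Fin.tail c (j.succAbove a) := by
      funext a; simp [Fin.tail]
    have h2 : (fun a => Fin.tail c ((0 : Fin (p + 2)).succAbove a)) = Fin.tail (Fin.tail c) := by
      funext a; simp [Fin.tail]
    have h3 (j : Fin (p + 1)) : (j.succ.succ : Fin (p + 3)).succAbove 1 = 1 := by
      rw [← Fin.succ_zero_eq_one, Fin.succ_succAbove_succ, Fin.succ_succAbove_zero]; rfl
    have h4 : ((0 : Fin (p + 2)).succ : Fin (p + 3)).succAbove 1 = 2 := by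
      rw [← Fin.succ_zero_eq_one, Fin.succ_succAbove_succ]; rfl
    -- the faces omitting `∇₀` and `∇₁` start with `∇₁ - ∇₂` and `∇₀ - ∇₂`; their difference is
    -- the letter `∇₀ - ∇₁`
    have h5 := put_add_left k ((c 0).diff (c 1)) ((c 1).diff (c 2)) l
      (cocycle k e p (Fin.tail (Fin.tail c)) l x)
    rw [Connection.diff_add_diff] at h5
    rw [cocycleFaces_succ, cocycleFaces_succ, cocycleFaces_succ, Fin.sum_univ_succ,
      Fin.sum_univ_succ (n := p + 2), h0]
    simp only [cocycle_succ_succ, h1, Fin.succ_succAbove_zero, smul_add, Finset.sum_add_distrib]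
    rw [Fin.sum_univ_succ (n := p + 1) (fun j => (-1 : A) ^ (j.succ : ℕ) • (-1 : A) ^ (l + 1) • _),
      Fin.sum_univ_succ (n := p + 1) (fun j => (-1 : A) ^ (j : ℕ) • _)]
    simp only [h2, h3, h4, h5, map_add, map_neg, map_sum, map_smul, Fin.val_zero, Fin.val_succ,
      pow_zero, one_smul, pow_succ, mul_neg, mul_one, neg_smul, smul_neg, neg_neg,
      Finset.sum_neg_distrib, smul_add, Finset.smul_sum, smul_comm ((-1 : A) ^ l)]
    change (put k ((c 1).bracket e) l _ + -((-1 : A) ^ l • put k ((c 1).diff (c 2)) l _)) + _ = _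
    abel

lemma cocycleInsert_succ_succ (η : Ω[A⁄k]) (p : ℕ) (c : Fin (p + 2) → Connection k A M) (l : ℕ)
    (x : M) : cocycleInsert k e η (p + 1) c (l + 1) x =
      put k ((c 0).bracket e) l (cocycleInsert k e η (p + 1) c l x) +
      (-1 : A) ^ l • put k ((c 0).diff (c 1)) l (cocycleInsert k e η p (Fin.tail c) l x) +
      (-1 : A) ^ l • put k (Forms.cons k η (ModuleCat.of A M)) l
        (cocycle k e (p + 1) c l x) := by
  cases l with
  | zero =>
    simp only [cocycleInsert, cocycle, LinearMap.comp_zero, LinearMap.zero_apply, map_zero,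
      smul_zero, add_zero]
  | succ l =>
    change Forms.insert k η (l + 1) _ _ = put k _ _ (Forms.insert k η l _ _) +
      _ • put k _ _ (Forms.insert k η l _ _) + _
    rw [cocycle_succ_succ, map_add, map_smul, insert_put, insert_put, map_add, map_smul]
    module

lemma cocycleInsert_zero_succ (η : Ω[A⁄k]) (c : Fin 1 → Connection k A M) (l : ℕ)
    (x : M) : cocycleInsert k e η 0 c (l + 1) x =
      put k ((c 0).bracket e) l (cocycleInsert k e η 0 c l x) +
      (-1 : A) ^ l • put k (Forms.cons k η (ModuleCat.of A M)) l
        (cocycle k e 0 c l x) := by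
  cases l with
  | zero =>
    simp only [cocycleInsert, LinearMap.zero_apply, map_zero, zero_add, pow_zero, one_smul]
    rfl
  | succ l =>
    change Forms.insert k η (l + 1) _ _ = put k _ _ (Forms.insert k η l _ _) + _
    rw [cocycle_zero_succ, insert_put]

/-- The formula without the splitting `σ` is a cocycle for the curved differential
`y ↦ dw y + (-1) ^ l e y` on `l`-forms: its boundary is the alternating sum of its faces. -/
lemma cocycle_boundary {w : A} (he : ∀ m, e (e m) = w • m) (l p : ℕ)
    (c : Fin (p + 1) → Connection k A M) (x : M) :
    cocycleInsert k e (KaehlerDifferential.D k A w) p c l x +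
      (-1 : A) ^ l • act k e l (cocycle k e p c l x) - (-1 : A) ^ p • cocycle k e p c l (e x) =
      cocycleFaces k e p c l x := by
  induction l generalizing p with
  | zero =>
    match p with
    | 0 =>
      simp only [cocycleInsert, cocycle, cocycleFaces, LinearMap.zero_apply, pow_zero, one_smul]
      change (0 : M) + e x - e x = 0
      rw [zero_add, sub_self]
    | 1 => simp [cocycleInsert, cocycle, cocycleFaces_succ]
    | p + 2 => simp [cocycleInsert, cocycle, cocycleFaces_succ]
  | succ l ih =>
    have h1 (c : Connection k A M) (y : Forms k l (ModuleCat.of A M)) :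
        act k e (l + 1) (put k (c.bracket e) l y) =
          put k (Forms.cons k (KaehlerDifferential.D k A w) (ModuleCat.of A M)) l y -
          put k (c.bracket e) l (act k e l y) := by
      rw [act_put, put_act, ← c.bracket_anticomm he, put_add_left, add_sub_cancel_left]
    cases p with
    | zero =>
      have h := congrArg (put k ((c 0).bracket e) l) (ih 0 c)
      simp only [map_add, map_sub, map_smul, cocycleFaces, LinearMap.zero_apply, map_zero] at h
      rw [cocycleInsert_zero_succ, cocycle_zero_succ, cocycle_zero_succ, h1]
      refine Eq.trans ?_ h
      module
    | succ p =>
      have h2 (y : Forms k l (ModuleCat.of A M)) :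
          act k e (l + 1) (put k ((c 0).diff (c 1)) l y) =
            put k ((c 0).diff (c 1)) l (act k e l y) - put k ((c 0).bracket e) l y +
              put k ((c 1).bracket e) l y := by
        have h := congrArg (put k · l y) ((c 0).bracket_sub_bracket (c 1) e)
        simp only [put_sub_left, ← put_act, ← act_put] at h
        rw [← sub_eq_zero, ← sub_eq_zero.2 h]
        abel
      rw [cocycleFaces_succ_succ, ← ih, ← ih, cocycleInsert_succ_succ, cocycle_succ_succ,
        cocycle_succ_succ]
      simp only [map_add, map_sub, map_smul, h1, h2, pow_succ]
      obtain h | h := neg_one_pow_eq_or A l <;> rw [h] <;> module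

end Cocycle

end Algebra

/-! ### Sums over exponents, sorted by word length -/

section Truncation

variable (k : Type u) [CommRing k] {A : Type u} [CommRing A] [Algebra k A]
  {M : Type u} [AddCommGroup M] [Module A M]

variable (A M) in
/-- Families of maps `M → Ω^{⊗ l} ⊗ M`, one for each `l`. -/
abbrev FormFamily : Type u := ∀ l : ℕ, M →ₗ[A] Forms k l (ModuleCat.of A M)

/-- Multiplication of a family by the letter `ψ` from the left. -/
def putFamily (ψ : M →ₗ[A] Ω[A⁄k] ⊗[A] M) : FormFamily k A M →ₗ[A] FormFamily k A M :=
  LinearMap.pi fun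
    | 0 => 0
    | l + 1 => (put k ψ l).compRight A ∘ₗ LinearMap.proj l

/-- A word as a family concentrated in one degree. -/
def wordFamily (L : List (M →ₗ[A] Ω[A⁄k] ⊗[A] M)) : FormFamily k A M :=
  Pi.single L.length (word k L)

lemma wordFamily_cons (ψ : M →ₗ[A] Ω[A⁄k] ⊗[A] M) (L : List (M →ₗ[A] Ω[A⁄k] ⊗[A] M)) :
    wordFamily k (ψ :: L) = putFamily k ψ (wordFamily k L) := by
  funext l
  cases l with
  | zero => exact Pi.single_eq_of_ne (Nat.succ_ne_zero _).symm _
  | succ l =>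
    change _ = put k ψ l ∘ₗ wordFamily k L l
    by_cases h : l = L.length
    · subst h
      rw [wordFamily, wordFamily, Pi.single_eq_same]
      exact Pi.single_eq_same _ _
    · rw [wordFamily, wordFamily, Pi.single_eq_of_ne h, LinearMap.comp_zero]
      exact Pi.single_eq_of_ne (fun h' => h (Nat.succ_injective h')) _

lemma wordFamily_replicate_append (ψ : M →ₗ[A] Ω[A⁄k] ⊗[A] M) (a : ℕ)
    (L : List (M →ₗ[A] Ω[A⁄k] ⊗[A] M)) :
    wordFamily k (List.replicate a ψ ++ L) = (putFamily k ψ ^ a) (wordFamily k L) := by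
  induction a with
  | zero => rfl
  | succ a ih =>
    rw [List.replicate_succ, List.cons_append, wordFamily_cons, ih, pow_succ']
    rfl

lemma putFamily_pow_apply_of_lt (ψ : M →ₗ[A] Ω[A⁄k] ⊗[A] M) (Z : FormFamily k A M) {a l : ℕ}
    (h : l < a) : (putFamily k ψ ^ a) Z l = 0 := by
  induction a generalizing l with
  | zero => exact absurd h l.not_lt_zero
  | succ a ih =>
    rw [pow_succ']
    cases l with
    | zero => rfl
    | succ l =>
      change put k ψ l ∘ₗ (putFamily k ψ ^ a) Z l = 0
      rw [ih (Nat.lt_of_succ_lt_succ h), LinearMap.comp_zero]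

/-- The truncated geometric series `Y = ∑_{a ≤ n} ψ ^ a Z` satisfies `Y = Z + ψ Y` in degrees at
most `n`. -/
lemma sum_putFamily_pow_succ (ψ : M →ₗ[A] Ω[A⁄k] ⊗[A] M) (Z : FormFamily k A M) {n l : ℕ}
    (h : l + 1 ≤ n) :
    (∑ a ∈ Finset.range (n + 1), (putFamily k ψ ^ a) Z) (l + 1) =
      Z (l + 1) + put k ψ l ∘ₗ (∑ a ∈ Finset.range (n + 1), (putFamily k ψ ^ a) Z) l := by
  have h1 : put k ψ l ∘ₗ (∑ a ∈ Finset.range (n + 1), (putFamily k ψ ^ a) Z) l =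
      putFamily k ψ (∑ a ∈ Finset.range (n + 1), (putFamily k ψ ^ a) Z) (l + 1) := rfl
  rw [h1, map_sum, Finset.sum_range_succ', Finset.sum_range_succ]
  simp only [← Module.End.mul_apply, ← pow_succ']
  rw [Pi.add_apply, Pi.add_apply, putFamily_pow_apply_of_lt k ψ Z (Nat.lt_succ_of_le h), add_zero]
  exact add_comm _ _

lemma sum_putFamily_pow_zero (ψ : M →ₗ[A] Ω[A⁄k] ⊗[A] M) (Z : FormFamily k A M) (n : ℕ) :
    (∑ a ∈ Finset.range (n + 1), (putFamily k ψ ^ a) Z) 0 = Z 0 := by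
  rw [Finset.sum_range_succ', Pi.add_apply, Finset.sum_apply, Finset.sum_eq_zero, zero_add]
  · rfl
  · exact fun a _ => putFamily_pow_apply_of_lt k ψ Z a.succ_pos

variable (e : M →ₗ[A] M)

/-- The sum of all words with exponents `κ_j ≤ n`, sorted by word length. -/
def truncatedSum (n p : ℕ) (c : Fin (p + 1) → Connection k A M) : FormFamily k A M :=
  ∑ κ : Fin (p + 1) → Fin (n + 1),
    (-1 : A) ^ (∑ j : Fin (p + 1), (j : ℕ) * ((κ j : ℕ) + 1)) •
      wordFamily k (letters k e p c fun j => κ j)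

lemma length_letters (p : ℕ) (c : Fin (p + 1) → Connection k A M) (κ : Fin (p + 1) → ℕ) :
    (letters k e p c κ).length + 1 = ∑ j, (κ j + 1) := by
  induction p with
  | zero => simp [letters]
  | succ p ih =>
    rw [Fin.sum_univ_succ, letters, List.length_append, List.length_cons, List.length_replicate,
      ih]
    simp only [Fin.tail]
    ring

/-- A family with its degree `l` part multiplied by `(-1) ^ l`. -/
def signFamily : FormFamily k A M →ₗ[A] FormFamily k A M :=
  LinearMap.pi fun l => (-1 : A) ^ l • LinearMap.proj l

lemma signFamily_wordFamily (L : List (M →ₗ[A] Ω[A⁄k] ⊗[A] M)) :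
    signFamily k (wordFamily k L) = (-1 : A) ^ L.length • wordFamily k L := by
  funext l
  change (-1 : A) ^ l • wordFamily k L l = (-1 : A) ^ L.length • wordFamily k L l
  by_cases h : l = L.length
  · rw [h]
  · rw [wordFamily, Pi.single_eq_of_ne h, smul_zero, smul_zero]

lemma truncatedSum_zero (n : ℕ) (c : Fin 1 → Connection k A M) :
    truncatedSum k e n 0 c =
      ∑ a ∈ Finset.range (n + 1), (putFamily k ((c 0).bracket e) ^ a) (wordFamily k []) := by
  rw [Finset.sum_range, truncatedSum]
  refine Fintype.sum_equiv (Equiv.funUnique (Fin 1) (Fin (n + 1))) _ _ fun κ => ?_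
  rw [← wordFamily_replicate_append, List.append_nil, Fin.sum_univ_one, Fin.val_zero, zero_mul,
    pow_zero, one_smul]
  rfl

lemma truncatedSum_succ (n p : ℕ) (c : Fin (p + 2) → Connection k A M) :
    truncatedSum k e n (p + 1) c =
      ∑ a ∈ Finset.range (n + 1), (putFamily k ((c 0).bracket e) ^ a)
        (signFamily k (putFamily k ((c 0).diff (c 1)) (truncatedSum k e n p (Fin.tail c)))) := by
  rw [Finset.sum_range, truncatedSum, ← (Fin.consEquiv fun _ => Fin (n + 1)).sum_comp,
    Fintype.sum_prod_type]
  refine Finset.sum_congr rfl fun a _ => ?_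
  rw [truncatedSum, map_sum, map_sum, map_sum]
  refine Finset.sum_congr rfl fun κ _ => ?_
  have h1 : letters k e (p + 1) c (fun j => (Fin.consEquiv (fun _ => Fin (n + 1)) (a, κ) j : ℕ)) =
      List.replicate a ((c 0).bracket e) ++
        (c 0).diff (c 1) :: letters k e p (Fin.tail c) fun j => κ j := rfl
  rw [h1, wordFamily_replicate_append, map_smul, map_smul, map_smul, ← wordFamily_cons,
    signFamily_wordFamily, map_smul, smul_smul, ← pow_add, List.length_cons, length_letters,
    Fin.sum_univ_succ, ← Finset.sum_add_distrib]
  refine congrArg₂ (· • ·) (congrArg _ ?_) rfl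
  simp [Fin.consEquiv, add_mul]

lemma truncatedSum_apply_of_le {n l : ℕ} (h : l ≤ n) (p : ℕ)
    (c : Fin (p + 1) → Connection k A M) : truncatedSum k e n p c l = cocycle k e p c l := by
  induction p generalizing l with
  | zero =>
    rw [truncatedSum_zero]
    induction l with
    | zero =>
      rw [sum_putFamily_pow_zero]
      exact Pi.single_eq_same (M := fun l => M →ₗ[A] Forms k l (ModuleCat.of A M)) 0 _
    | succ l ih =>
      rw [sum_putFamily_pow_succ k _ _ h, ih (Nat.le_of_succ_le h)]
      exact (congrArg (· + _) (Pi.single_eq_of_ne (Nat.succ_ne_zero l) _)).trans (zero_add _)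
  | succ p ihp =>
    rw [truncatedSum_succ]
    induction l with
    | zero =>
      rw [sum_putFamily_pow_zero]
      exact smul_zero ((-1 : A) ^ 0)
    | succ l ih =>
      rw [sum_putFamily_pow_succ k _ _ h, ih (Nat.le_of_succ_le h)]
      refine (add_comm _ _).trans (congrArg (_ + ·) ?_)
      rw [← ihp (Nat.le_of_succ_le h) (Fin.tail c)]
      rfl

end Truncation

/-! ### Splittings and the coefficient modules of the Atiyah complex -/

section Coefficients

variable (k : Type u) [CommRing k] {A : Type u} [CommRing A] [Algebra k A]
  {M : Type u} [AddCommGroup M] [Module k M] [Module A M] [IsScalarTower k A M]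

lemma omegaTensor_hom_ext {M N : Type u} [AddCommGroup M] [Module A M]
    [AddCommGroup N] [Module A N]
    {f g : Ω[A⁄k] ⊗[A] M →ₗ[A] N}
    (h : ∀ a m, f (KaehlerDifferential.D k A a ⊗ₜ m) = g (KaehlerDifferential.D k A a ⊗ₜ m)) :
    f = g := by
  ext ω m
  have hω : ω ∈ Submodule.span A (Set.range (KaehlerDifferential.D k A)) := by
    rw [KaehlerDifferential.span_range_derivation]; trivial
  change f (ω ⊗ₜ m) = g (ω ⊗ₜ m)
  induction hω using Submodule.span_induction with
  | mem x hx =>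
    obtain ⟨a, rfl⟩ := hx
    exact h a m
  | zero => simp only [zero_tmul, map_zero]
  | add x y _ _ hx hy => simp only [add_tmul, map_add, hx, hy]
  | smul c x _ hx => simp only [← smul_tmul', map_smul, hx]

namespace Connection

variable {k}

lemma mul_splitting (c : Connection k A M) (m : M) : Jet.mul k A M (c.splitting m) = m := by
  have h : Jet.mul k A M ∘ₗ Jet.incl k A M = 0 := omegaTensor_hom_ext k fun a m => by
    rw [LinearMap.comp_apply, Jet.incl_tmul, map_sub, Jet.mul_mk, Jet.mul_mk, one_smul, sub_self]
    rfl
  change Jet.mul k A M (Jet.mk k 1 m + Jet.incl k A M (c.toFun m)) = m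
  rw [map_add, Jet.mul_mk, one_smul, ← LinearMap.comp_apply, h, LinearMap.zero_apply, add_zero]

lemma map_splitting (c : Connection k A M) (e : M →ₗ[A] M) (m : M) :
    Jet.map k e (c.splitting m) = c.splitting (e m) - Jet.incl k A M (c.bracket e m) := by
  have h : Jet.map k e ∘ₗ Jet.incl k A M = Jet.incl k A M ∘ₗ e.lTensor Ω[A⁄k] :=
    omegaTensor_hom_ext k fun a m => by
      rw [LinearMap.comp_apply, LinearMap.comp_apply, LinearMap.lTensor_tmul, Jet.incl_tmul,
        Jet.incl_tmul, map_sub, Jet.map_mk, Jet.map_mk, map_smul]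
  change Jet.map k e (Jet.mk k 1 m + Jet.incl k A M (c.toFun m)) =
    Jet.mk k 1 (e m) + Jet.incl k A M (c.toFun (e m)) -
      Jet.incl k A M (c.toFun (e m) - e.lTensor Ω[A⁄k] (c.toFun m))
  rw [map_add, ← LinearMap.comp_apply (f := Jet.map k e), h, LinearMap.comp_apply, Jet.map_mk,
    map_sub]
  abel

lemma splitting_sub_splitting (c c' : Connection k A M) (m : M) :
    c.splitting m - c'.splitting m = Jet.incl k A M (c.diff c' m) := by
  change Jet.mk k 1 m + Jet.incl k A M (c.toFun m) -
    (Jet.mk k 1 m + Jet.incl k A M (c'.toFun m)) = Jet.incl k A M (c.toFun m - c'.toFun m)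
  rw [map_sub, add_sub_add_left_eq_sub]

end Connection

namespace Coeff

variable (A M) in
/-- The inclusion `Ω ⊗ M → J¹(M)` into the `q`-th coefficient module if `q < n`, zero if
`q ≥ n`. -/
def incl : ∀ n q : ℕ, Ω[A⁄k] ⊗[A] M →ₗ[A] Coeff k A M n q
  | 0, _ => 0
  | _ + 1, 0 => Jet.incl k A M
  | n + 1, q + 1 => incl n q

variable (c c' : Connection k A M)

lemma proj_split : ∀ (n q : ℕ) (m : M),
    proj k A M n q (split k c n q m) = split k c n (q + 1) m
  | 0, _, _ => rfl
  | 1, 0, m => c.mul_splitting m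
  | _ + 2, 0, _ => rfl
  | 1, q + 1, m => proj_split 0 q m
  | n + 2, q + 1, m => proj_split (n + 1) q m

lemma lower_split : ∀ (n q : ℕ) (y : Ω[A⁄k] ⊗[A] M),
    lower k A M n q ((split k c n (q + 1)).lTensor Ω[A⁄k] y) = incl k A M n q y
  | 0, _, _ => rfl
  | 1, 0, y => congrArg (Jet.incl k A M) (LinearMap.lTensor_id_apply _ _ y)
  | _ + 2, 0, y => by
    refine congrArg (Jet.incl k A M) ((LinearMap.lTensor_comp_apply _ _ _ y).symm.trans ?_)
    have h : Jet.mul k A M ∘ₗ c.splitting = LinearMap.id := LinearMap.ext c.mul_splitting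
    exact (congrArg (fun f : M →ₗ[A] M => f.lTensor Ω[A⁄k] y) h).trans
      (LinearMap.lTensor_id_apply _ _ y)
  | 1, q + 1, y => lower_split 0 q y
  | n + 2, q + 1, y => lower_split (n + 1) q y

lemma map_split (e : M →ₗ[A] M) : ∀ (n q : ℕ) (m : M),
    map k e n q (split k c n q m) = split k c n q (e m) - incl k A M n q (c.bracket e m)
  | 0, 0, m => (sub_zero (e m)).symm
  | 0, _ + 1, _ => rfl
  | _ + 1, 0, m => c.map_splitting e m
  | n + 1, q + 1, m => map_split e n q m

lemma split_sub_split : ∀ (n q : ℕ) (m : M),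
    split k c n q m - split k c' n q m = incl k A M n q (c.diff c' m)
  | 0, 0, m => sub_self m
  | 0, _ + 1, _ => rfl
  | _ + 1, 0, m => c.splitting_sub_splitting c' m
  | n + 1, q + 1, m => split_sub_split n q m

lemma split_eq_zero : ∀ {n q : ℕ}, n < q → split k c n q = 0
  | _, 0, h => absurd h (Nat.not_lt_zero _)
  | 0, _ + 1, _ => rfl
  | n + 1, q + 1, h => split_eq_zero (n := n) (q := q) (Nat.lt_of_succ_lt_succ h)

end Coeff

end Coefficients

/-! ### The differential of the local formula -/

section Formula

variable (k : Type u) [CommRing k] {A : Type u} [CommRing A] [Algebra k A]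
  {M : Type u} [AddCommGroup M] [Module k M] [Module A M] [IsScalarTower k A M] (e : M →ₗ[A] M)
  (n : ℕ)

/-- The map `Ω^{⊗ q} ⊗ M → Ω^{⊗ q} ⊗ J¹(M)` (or `Ω^{⊗ n} ⊗ M` if `q = n`, zero if `q > n`) induced
by the splitting of a connection. -/
abbrev splitForms (c : Connection k A M) (q : ℕ) :
    Forms k q (ModuleCat.of A M) →ₗ[A] Forms k q (Coeff k A M n q) :=
  Forms.map k q (N := ModuleCat.of A M) (Coeff.split k c n q)

/-- The map `Ω^{⊗ (q + 1)} ⊗ M → Ω^{⊗ q} ⊗ J¹(M)` induced by the inclusion `Ω ⊗ M → J¹(M)` if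
`q < n`; it is zero if `q ≥ n`. -/
def inclForms (q : ℕ) :
    Forms k (q + 1) (ModuleCat.of A M) →ₗ[A] Forms k q (Coeff k A M n q) :=
  Forms.map k q (N := OmegaTensor k (ModuleCat.of A M)) (Coeff.incl k A M n q) ∘ₗ
    (Forms.shift k q (ModuleCat.of A M)).symm.toLinearMap

lemma inclForms_put (ψ : M →ₗ[A] Ω[A⁄k] ⊗[A] M) (q : ℕ) (y : Forms k q (ModuleCat.of A M)) :
    inclForms k n q (put k ψ q y) =
      Forms.map k q (N := ModuleCat.of A M) (Coeff.incl k A M n q ∘ₗ ψ) y :=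
  Forms.map_map k q (N := ModuleCat.of A M) (N' := OmegaTensor k (ModuleCat.of A M)) _ ψ y

lemma inclForms_put_diff (c c' : Connection k A M) (q : ℕ) (y : Forms k q (ModuleCat.of A M)) :
    inclForms k n q (put k (c.diff c') q y) = splitForms k n c q y - splitForms k n c' q y := by
  rw [inclForms_put, ← Forms.map_sub_left]
  exact congrArg (fun f => Forms.map k q (N := ModuleCat.of A M) f y)
    (LinearMap.ext fun m => (Coeff.split_sub_split k c c' n q m).symm)

lemma map_splitForms (c : Connection k A M) (q : ℕ) (y : Forms k q (ModuleCat.of A M)) :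
    Forms.map k q (Coeff.map k e n q) (splitForms k n c q y) =
      splitForms k n c q (act k e q y) - inclForms k n q (put k (c.bracket e) q y) := by
  rw [inclForms_put, Forms.map_map, Forms.map_map, ← Forms.map_sub_left]
  exact congrArg (fun f => Forms.map k q (N := ModuleCat.of A M) f y)
    (LinearMap.ext fun m => Coeff.map_split k c e n q m)

lemma formula_apply (p : ℕ) (c : Fin (p + 1) → Connection k A M) (x : M) (q : ℕ) :
    formula k e n p c x q = splitForms k n (c 0) q (cocycle k e p c q x) := by
  have h (L : List (M →ₗ[A] Ω[A⁄k] ⊗[A] M)) :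
      sigma k (c 0) n L.length (word k L x) q = splitForms k n (c 0) q (wordFamily k L q x) := by
    change Pi.single (M := fun q => (Forms k q (Coeff k A M n q) : Type u)) L.length
      (splitForms k n (c 0) L.length (word k L x)) q = _
    by_cases hq : q = L.length
    · subst hq
      rw [Pi.single_eq_same, wordFamily, Pi.single_eq_same]
    · rw [Pi.single_eq_of_ne hq, wordFamily, Pi.single_eq_of_ne hq, LinearMap.zero_apply, map_zero]
  have h' : formula k e n p c x q = splitForms k n (c 0) q (truncatedSum k e n p c q x) := by
    rw [formula, truncatedSum, LinearMap.sum_apply, Finset.sum_apply, Finset.sum_apply,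
      LinearMap.sum_apply, map_sum]
    refine Finset.sum_congr rfl fun κ _ => ?_
    rw [Pi.smul_apply, LinearMap.smul_apply, LinearMap.smul_apply, Pi.smul_apply, map_smul, ← h]
    rfl
  rw [h']
  by_cases hq : q ≤ n
  · rw [truncatedSum_apply_of_le k e hq]
  · rw [splitForms, Coeff.split_eq_zero k (c 0) (not_le.1 hq), Forms.map_zero_left,
      Forms.map_zero_left]

/-- The part of `d f` in `q`-forms before the cancellation between the letters `[∇₀, e]` produced
by `m` and by the failure of the splitting to commute with `e`. -/
lemma d_formula_apply (w : A) (p : ℕ) (c : Fin (p + 1) → Connection k A M) (x : M) (q : ℕ) :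
    At.d k n w e (formula k e n p c x) q =
      splitForms k n (c 0) q (cocycleInsert k e (KaehlerDifferential.D k A w) p c q x +
        (-1 : A) ^ q • act k e q (cocycle k e p c q x)) +
      (-1 : A) ^ q • inclForms k n q (cocycle k e p c (q + 1) x -
        put k ((c 0).bracket e) q (cocycle k e p c q x)) := by
  have hB : At.B k M n (KaehlerDifferential.D k A w) (formula k e n p c x) q =
      splitForms k n (c 0) q (cocycleInsert k e (KaehlerDifferential.D k A w) p c q x) := by
    cases q with
    | zero => exact (map_zero (splitForms k n (c 0) 0)).symm
    | succ q =>
      change Forms.map k (q + 1) (Coeff.proj k A M n q)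
        (Forms.insert k _ q _ (formula k e n p c x q)) =
        splitForms k n (c 0) (q + 1) (Forms.insert k _ q _ (cocycle k e p c q x))
      rw [formula_apply, Forms.insert_map, Forms.map_map]
      exact congrArg (fun f => Forms.map k (q + 1) (N := ModuleCat.of A M) f _)
        (LinearMap.ext fun m => Coeff.proj_split k (c 0) n q m)
  have hm : At.m k A M n (At.gamma k A M n (formula k e n p c x)) q =
      (-1 : A) ^ (q + 1) • inclForms k n q (cocycle k e p c (q + 1) x) := by
    change Forms.map k q (Coeff.lower k A M n q) ((Forms.shift k q _).symm
      ((-1 : A) ^ (q + 1) • formula k e n p c x (q + 1))) = _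
    rw [map_smul, map_smul, formula_apply]
    refine congrArg (_ • ·) ?_
    refine (Forms.map_map k q (N := OmegaTensor k (ModuleCat.of A M))
      (N' := OmegaTensor k (Coeff k A M n (q + 1))) (Coeff.lower k A M n q)
      ((Coeff.split k (c 0) n (q + 1)).lTensor Ω[A⁄k]) (cocycle k e p c (q + 1) x)).trans ?_
    exact congrArg (fun f => Forms.map k q (N := OmegaTensor k (ModuleCat.of A M)) f _)
      (LinearMap.ext fun y => Coeff.lower_split k (c 0) n q y)
  have he : At.map k n e (At.gamma k A M n (formula k e n p c x)) q =
      (-1 : A) ^ q • (splitForms k n (c 0) q (act k e q (cocycle k e p c q x)) -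
        inclForms k n q (put k ((c 0).bracket e) q (cocycle k e p c q x))) := by
    change Forms.map k q (Coeff.map k e n q) ((-1 : A) ^ q • formula k e n p c x q) = _
    rw [map_smul, formula_apply, map_splitForms]
  change At.B k M n _ _ q - At.m k A M n _ q + At.map k n e _ q = _
  rw [hB, hm, he, map_add, map_sub, map_smul, pow_succ]
  module

lemma d_formula_zero {w : A} (he : ∀ m, e (e m) = w • m) (c : Fin 1 → Connection k A M) (x : M) :
    At.d k n w e (formula k e n 0 c x) - formula k e n 0 c (e x) = 0 := by
  funext q
  have h := cocycle_boundary k e he q 0 c x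
  rw [pow_zero, one_smul, sub_eq_iff_eq_add] at h
  rw [Pi.sub_apply, d_formula_apply, formula_apply, h, cocycle_zero_succ, sub_self, map_zero,
    smul_zero, add_zero]
  change splitForms k n (c 0) q (0 + _) - _ = 0
  rw [zero_add, sub_self]

lemma d_formula_succ {w : A} (he : ∀ m, e (e m) = w • m) (p : ℕ)
    (c : Fin (p + 2) → Connection k A M) (x : M) :
    At.d k n w e (formula k e n (p + 1) c x) -
        (-1 : A) ^ (p + 1) • formula k e n (p + 1) c (e x) =
      ∑ j : Fin (p + 2), (-1 : A) ^ (j : ℕ) •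
        formula k e n p (fun a => c (j.succAbove a)) x := by
  funext q
  have h := cocycle_boundary k e he q (p + 1) c x
  rw [sub_eq_iff_eq_add, cocycleFaces_succ, Fin.sum_univ_succ] at h
  rw [Pi.sub_apply, d_formula_apply, Pi.smul_apply, formula_apply, h, cocycle_succ_succ,
    add_sub_cancel_left, map_smul, smul_smul, ← pow_add, inclForms_put_diff, Finset.sum_apply,
    Fin.sum_univ_succ (n := p + 1) (fun j => ((-1 : A) ^ (j : ℕ) • formula k e n p _ x) q)]
  simp only [Pi.smul_apply, formula_apply, Fin.succ_succAbove_zero, map_add, map_sum, map_smul]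
  have h0 : (fun a => c ((0 : Fin (p + 2)).succAbove a)) = Fin.tail c := by
    funext a; simp [Fin.tail]
  have h1 : (-1 : A) ^ (q + (q + 1)) = -1 := Odd.neg_one_pow ⟨q, by ring⟩
  -- the face omitting `∇₀` uses the splitting of `∇₁`; the difference of the two splittings is
  -- the contribution of the letter `∇₀ - ∇₁` through `m`
  have h2 : c ((0 : Fin (p + 2)).succAbove 0) = c 1 := rfl
  rw [h0, h1, h2, Fin.val_zero, pow_zero, one_smul, one_smul]
  module

end Formula

/-! ### Degrees -/

section Degree

variable (k : Type u) [CommRing k] {A : Type u} [CommRing A] [Algebra k A]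
  {M₀ M₁ : Type u} [AddCommGroup M₀] [Module A M₀] [AddCommGroup M₁] [Module A M₁]

variable {k} in
lemma Connection.prod_parityProj (c₀ : Connection k A M₀) (c₁ : Connection k A M₁) (b : ZMod 2)
    (m : M₀ × M₁) : (c₀.prod c₁).toFun (parityProj A M₀ M₁ b m) =
      (parityProj A M₀ M₁ b).lTensor Ω[A⁄k] ((c₀.prod c₁).toFun m) := by
  have h (m : M₀ × M₁) : (c₀.prod c₁).toFun m =
      (LinearMap.inl A M₀ M₁).lTensor Ω[A⁄k] (c₀.toFun m.1) +
        (LinearMap.inr A M₀ M₁).lTensor Ω[A⁄k] (c₁.toFun m.2) := rfl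
  rw [h, h, map_add, ← LinearMap.lTensor_comp_apply, ← LinearMap.lTensor_comp_apply]
  by_cases hb : b = 0
  · have h0 : parityProj A M₀ M₁ b = LinearMap.inl A M₀ M₁ ∘ₗ LinearMap.fst A M₀ M₁ := if_pos hb
    have h1 : (LinearMap.inl A M₀ M₁ ∘ₗ LinearMap.fst A M₀ M₁) ∘ₗ LinearMap.inl A M₀ M₁ =
        LinearMap.inl A M₀ M₁ := rfl
    have h2 : (LinearMap.inl A M₀ M₁ ∘ₗ LinearMap.fst A M₀ M₁) ∘ₗ LinearMap.inr A M₀ M₁ = 0 :=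
      LinearMap.ext fun _ => rfl
    rw [h0, h1, h2, LinearMap.lTensor_zero, LinearMap.zero_apply]
    exact congrArg _ ((congrArg _ (map_zero c₁.toFun)).trans (map_zero _))
  · have h0 : parityProj A M₀ M₁ b = LinearMap.inr A M₀ M₁ ∘ₗ LinearMap.snd A M₀ M₁ := if_neg hb
    have h1 : (LinearMap.inr A M₀ M₁ ∘ₗ LinearMap.snd A M₀ M₁) ∘ₗ LinearMap.inr A M₀ M₁ =
        LinearMap.inr A M₀ M₁ := rfl
    have h2 : (LinearMap.inr A M₀ M₁ ∘ₗ LinearMap.snd A M₀ M₁) ∘ₗ LinearMap.inl A M₀ M₁ = 0 :=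
      LinearMap.ext fun _ => rfl
    rw [h0, h1, h2, LinearMap.lTensor_zero, LinearMap.zero_apply]
    exact congrArg (· + _) ((congrArg _ (map_zero c₀.toFun)).trans (map_zero _))

variable {M : Type u} [AddCommGroup M] [Module A M] {P : ZMod 2 → M →ₗ[A] M} {e : M →ₗ[A] M}

/-- If the connections preserve a `ℤ/2`-grading with projections `P` for which `e` is odd, then
`cocycle p c l`, a sum of words in `l - p` odd and `p` even letters, shifts degrees by `p + l`. -/
lemma act_cocycle (he : ∀ b m, e (P b m) = P (b + 1) (e m)) (p : ℕ)
    {c : Fin (p + 1) → Connection k A M}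
    (hc : ∀ j b m, (c j).toFun (P b m) = (P b).lTensor Ω[A⁄k] ((c j).toFun m)) (l : ℕ)
    (b : ZMod 2) (x : M) :
    act k (P (b + p + l)) l (cocycle k e p c l x) = cocycle k e p c l (P b x) := by
  have hb (c : Connection k A M) (hc : ∀ b m, c.toFun (P b m) = (P b).lTensor Ω[A⁄k] (c.toFun m))
      (b : ZMod 2) : (P (b + 1)).lTensor Ω[A⁄k] ∘ₗ c.bracket e = c.bracket e ∘ₗ P b := by
    have h : P (b + 1) ∘ₗ e = e ∘ₗ P b := LinearMap.ext fun m => (he b m).symm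
    ext m
    change (P (b + 1)).lTensor Ω[A⁄k] (c.toFun (e m) - e.lTensor Ω[A⁄k] (c.toFun m)) =
      c.toFun (e (P b m)) - e.lTensor Ω[A⁄k] (c.toFun (P b m))
    rw [map_sub, he, hc, hc, ← LinearMap.lTensor_comp_apply, ← LinearMap.lTensor_comp_apply, h]
  induction l generalizing p with
  | zero =>
    cases p with
    | zero => rw [Nat.cast_zero, add_zero, add_zero]; rfl
    | succ p => exact map_zero _
  | succ l ih =>
    have h1 (q : ℕ) : b + q + (l + 1 : ℕ) = b + q + l + 1 := by push_cast; ring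
    cases p with
    | zero => rw [cocycle_zero_succ, cocycle_zero_succ, h1, act_put, hb _ (hc 0), ← put_act,
        ih 0 hc]
    | succ p =>
      have hd (b : ZMod 2) : (P b).lTensor Ω[A⁄k] ∘ₗ (c 0).diff (c 1) =
          (c 0).diff (c 1) ∘ₗ P b := by
        ext m
        change (P b).lTensor Ω[A⁄k] ((c 0).toFun m - (c 1).toFun m) =
          (c 0).toFun (P b m) - (c 1).toFun (P b m)
        rw [map_sub, hc, hc]
      have h2 : b + (p + 1 : ℕ) + l + 1 = b + p + l := by
        have : (1 + 1 : ZMod 2) = 0 := rfl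
        push_cast
        linear_combination this
      rw [cocycle_succ_succ, cocycle_succ_succ, map_add, map_smul, h1, act_put, act_put,
        hb _ (hc 0), ← put_act, ih (p + 1) hc, h2, hd, ← put_act,
        ih p (c := Fin.tail c) fun j => hc j.succ]

lemma map_formula_apply [Module k M] [IsScalarTower k A M]
    (he : ∀ b m, e (P b m) = P (b + 1) (e m)) (n p : ℕ) {c : Fin (p + 1) → Connection k A M}
    (hc : ∀ j b m, (c j).toFun (P b m) = (P b).lTensor Ω[A⁄k] ((c j).toFun m)) (q : ℕ)
    {b : ZMod 2} {x : M} (hx : P b x = x) :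
    Forms.map k q (Coeff.map k (P (b + p + q)) n q) (formula k e n p c x q) =
      formula k e n p c x q := by
  have h : (c 0).bracket (P (b + p + q)) = 0 := LinearMap.ext fun m => sub_eq_zero.2 (hc 0 _ m)
  have h' : put k (0 : M →ₗ[A] Ω[A⁄k] ⊗[A] M) q (cocycle k e p c q x) = 0 :=
    Forms.map_zero_left k q (N := ModuleCat.of A M) (N' := OmegaTensor k (ModuleCat.of A M)) _
  rw [formula_apply, map_splitForms, h, h', map_zero, sub_zero, act_cocycle k he p hc, hx]

end Degree

/-! ### Compatibility with restriction -/

section Restriction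

variable (k : Type u) [CommRing k] {A B : Type u} [CommRing A] [Algebra k A] [CommRing B]
  [Algebra k B] (ρ : A →ₐ[k] B)
  {M M' : Type u} [AddCommGroup M] [Module A M] [AddCommGroup M'] [Module B M']
  (g : M →ₛₗ[(ρ : A →+* B)] M')

lemma put_res {ψ : M →ₗ[A] Ω[A⁄k] ⊗[A] M} {ψ' : M' →ₗ[B] Ω[B⁄k] ⊗[B] M'}
    (H : ∀ m, omegaRes k ρ g (ψ m) = ψ' (g m)) (l : ℕ) (y : Forms k l (ModuleCat.of A M)) :
    Forms.res k ρ (l + 1) (N := ModuleCat.of A M) (N' := ModuleCat.of B M') g (put k ψ l y) =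
      put k ψ' l (Forms.res k ρ l (N := ModuleCat.of A M) (N' := ModuleCat.of B M') g y) :=
  Forms.res_map k ρ l (N := ModuleCat.of A M) (N' := ModuleCat.of B M')
    (P := OmegaTensor k (ModuleCat.of A M)) (P' := OmegaTensor k (ModuleCat.of B M')) H y

lemma split_res [Module k M] [IsScalarTower k A M] [Module k M'] [IsScalarTower k B M']
    {c : Connection k A M} {c' : Connection k B M'}
    (H : ∀ m, c'.toFun (g m) = omegaRes k ρ g (c.toFun m)) : ∀ (n q : ℕ) (m : M),
    Coeff.res k ρ g n q (Coeff.split k c n q m) = Coeff.split k c' n q (g m)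
  | 0, 0, _ => rfl
  | 0, _ + 1, _ => rfl
  | _ + 1, 0, m => by
    change Jet.res k ρ g (Jet.mk k 1 m + Jet.incl k A M (c.toFun m)) =
      Jet.mk k 1 (g m) + Jet.incl k B M' (c'.toFun (g m))
    rw [map_add, Jet.incl_res, H, Jet.res_mk, map_one]
  | n + 1, q + 1, m => split_res H n q m

variable {e : M →ₗ[A] M} {e' : M' →ₗ[B] M'}

lemma cocycle_res (he : ∀ m, g (e m) = e' (g m)) (p : ℕ) {c : Fin (p + 1) → Connection k A M}
    {c' : Fin (p + 1) → Connection k B M'}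
    (H : ∀ j m, (c' j).toFun (g m) = omegaRes k ρ g ((c j).toFun m)) (l : ℕ) (x : M) :
    Forms.res k ρ l (N := ModuleCat.of A M) (N' := ModuleCat.of B M') g (cocycle k e p c l x) =
      cocycle k e' p c' l (g x) := by
  have hb (c : Connection k A M) (c' : Connection k B M')
      (H : ∀ m, c'.toFun (g m) = omegaRes k ρ g (c.toFun m)) (m : M) :
      omegaRes k ρ g (c.bracket e m) = c'.bracket e' (g m) := by
    change omegaRes k ρ g (c.toFun (e m) - e.lTensor Ω[A⁄k] (c.toFun m)) =
      c'.toFun (e' (g m)) - e'.lTensor Ω[B⁄k] (c'.toFun (g m))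
    rw [map_sub, omegaRes_lTensor k ρ he, ← he, H, H]
  induction l generalizing p with
  | zero =>
    cases p with
    | zero => rfl
    | succ p => exact map_zero g
  | succ l ih =>
    cases p with
    | zero =>
      rw [cocycle_zero_succ, cocycle_zero_succ, put_res k ρ g (hb _ _ (H 0)), ih 0 H]
    | succ p =>
      have hd (m : M) : omegaRes k ρ g ((c 0).diff (c 1) m) = (c' 0).diff (c' 1) (g m) := by
        change omegaRes k ρ g ((c 0).toFun m - (c 1).toFun m) =
          (c' 0).toFun (g m) - (c' 1).toFun (g m)
        rw [map_sub, H, H]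
      rw [cocycle_succ_succ, cocycle_succ_succ, map_add, LinearMap.map_smulₛₗ,
        put_res k ρ g (hb _ _ (H 0)), put_res k ρ g hd, ih (p + 1) H,
        ih p (c := Fin.tail c) (c' := Fin.tail c') fun j => H j.succ]
      simp

lemma formula_res [Module k M] [IsScalarTower k A M] [Module k M'] [IsScalarTower k B M']
    (he : ∀ m, g (e m) = e' (g m)) (n p : ℕ) {c : Fin (p + 1) → Connection k A M}
    {c' : Fin (p + 1) → Connection k B M'}
    (H : ∀ j m, (c' j).toFun (g m) = omegaRes k ρ g ((c j).toFun m)) (x : M) :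
    At.res k ρ n g (formula k e n p c x) = formula k e' n p c' (g x) := by
  funext q
  rw [formula_apply, ← cocycle_res k ρ g he p H]
  change Forms.res k ρ q (Coeff.res k ρ g n q) (formula k e n p c x q) = _
  rw [formula_apply]
  exact Forms.res_map k ρ q (N := ModuleCat.of A M) (N' := ModuleCat.of B M')
    (split_res k ρ g (H 0) n q) _

end Restriction

/-! ### Gluing and the Čech complex -/

section Geometry

variable (k : Type u) [Field k] {X : Scheme.{u}} [X.Over (Spec (.of k))] {w : Γ(X, ⊤)}

namespace MatrixFactorization

variable (E : MatrixFactorization X w)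

lemma res_res {V W Z : X.Opens} (h : W ≤ V) (h' : Z ≤ W) (s : E.Sec V) :
    E.res k h' (E.res k h s) = E.res k (h'.trans h) s := by
  have H (M : X.Modules) (s : Γ(M, V)) :
      secRes k M h' (secRes k M h s) = secRes k M (h'.trans h) s := by
    change M.presheaf.map (homOfLE h').op (M.presheaf.map (homOfLE h).op s) =
      M.presheaf.map (homOfLE (h'.trans h)).op s
    rw [← ConcreteCategory.comp_apply, ← Functor.map_comp]
    rfl
  exact Prod.ext (H _ _) (H _ _)

lemma e_e (V : X.Opens) (s : E.Sec V) : E.e V (E.e V s) =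
    funRes k (le_top : V ≤ ⊤) w • s :=
  Prod.ext (E.e₁_e₀ V s.1) (E.e₀_e₁ V s.2)

lemma e_parityProj (V : X.Opens) (b : ZMod 2) (s : E.Sec V) :
    E.e V (parityProj Γ(X, V) Γ(E.E₀, V) Γ(E.E₁, V) b s) =
      parityProj Γ(X, V) Γ(E.E₀, V) Γ(E.E₁, V) (b + 1) (E.e V s) := by
  fin_cases b
  · exact Prod.ext (map_zero (E.e₁.app V).hom) rfl
  · exact Prod.ext rfl (map_zero (E.e₀.app V).hom)

lemma res_parityProj {V W : X.Opens} (h : W ≤ V) (b : ZMod 2) (s : E.Sec V) :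
    E.res k h (parityProj Γ(X, V) Γ(E.E₀, V) Γ(E.E₁, V) b s) =
      parityProj Γ(X, W) Γ(E.E₀, W) Γ(E.E₁, W) b (E.res k h s) := by
  fin_cases b
  · exact Prod.ext rfl (map_zero (secRes k E.E₁ h))
  · exact Prod.ext (map_zero (secRes k E.E₀ h)) rfl

variable {E k}

lemma LocalConnection.at_res {U : X.Opens} (c : E.LocalConnection k U) {W W' : X.Opens}
    (hW : IsAffineOpen W) (hW' : IsAffineOpen W') (hU : W ≤ U) (h : W' ≤ W) (s : E.Sec W) :
    (c.at k W' hW' (h.trans hU)).toFun (E.res k h s) =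
      omegaRes k (funRes k h) (E.res k h) ((c.at k W hW hU).toFun s) := by
  have h0 (y : Ω[Γ(X, W)⁄k] ⊗[Γ(X, W)] Γ(E.E₀, W)) :=
    omegaRes_lTensor k (funRes k h) (g := secRes k E.E₀ h) (h := E.res k h)
      (f := LinearMap.inl Γ(X, W) Γ(E.E₀, W) Γ(E.E₁, W))
      (f' := LinearMap.inl Γ(X, W') Γ(E.E₀, W') Γ(E.E₁, W'))
      (fun _ => Prod.ext rfl (map_zero (secRes k E.E₁ h))) y
  have h1 (y : Ω[Γ(X, W)⁄k] ⊗[Γ(X, W)] Γ(E.E₁, W)) :=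
    omegaRes_lTensor k (funRes k h) (g := secRes k E.E₁ h) (h := E.res k h)
      (f := LinearMap.inr Γ(X, W) Γ(E.E₀, W) Γ(E.E₁, W))
      (f' := LinearMap.inr Γ(X, W') Γ(E.E₀, W') Γ(E.E₁, W'))
      (fun _ => Prod.ext (map_zero (secRes k E.E₀ h)) rfl) y
  change (LinearMap.inl _ _ _).lTensor _ ((c.conn₀ W' hW' _).toFun (secRes k E.E₀ h s.1)) +
      (LinearMap.inr _ _ _).lTensor _ ((c.conn₁ W' hW' _).toFun (secRes k E.E₁ h s.2)) =
    omegaRes k (funRes k h) (E.res k h)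
      ((LinearMap.inl _ _ _).lTensor _ ((c.conn₀ W hW hU).toFun s.1) +
        (LinearMap.inr _ _ _).lTensor _ ((c.conn₁ W hW hU).toFun s.2))
  rw [map_add, h0, h1, c.compat₀ W W' hW hW' hU h, c.compat₁ W W' hW hW' hU h]

variable (n : ℕ) {N : ℕ} {U : Fin N → X.Opens} (c : ∀ j, E.LocalConnection k (U j))

/-- The connections `∇_{i_0}, …, ∇_{i_p}` over an affine open subset of
`U_{i_0} ∩ ⋯ ∩ U_{i_p}`. -/
abbrev connections {p : ℕ} (i : Fin (p + 1) ↪o Fin N) {V : X.Opens} (W : AffineIn (inter U i) V)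
    (a : Fin (p + 1)) : Connection k Γ(X, W.1) (E.Sec W.1) :=
  (c (i a)).at k W.1 W.2.1 (W.2.2.2.trans (iInf_le (fun a => U (i a)) a))

/-- The map `f_{i_0 … i_p}` over an affine open subset of `U_{i_0} ∩ ⋯ ∩ U_{i_p}`. -/
abbrev localFormula {p : ℕ} (i : Fin (p + 1) ↪o Fin N) {V : X.Opens} (W : AffineIn (inter U i) V) :
    E.Sec W.1 →ₗ[Γ(X, W.1)] E.AtSec k n W.1 :=
  formula k (E.e W.1) n p (connections c i W)

/-- The morphism `f_{i_0 … i_p}`: the local formula, glued over the affine open subsets. -/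
def formulaHom {p : ℕ} (i : Fin (p + 1) ↪o Fin N) : E.AtHom k n (inter U i) where
  app V :=
    { toFun s := ⟨fun W => localFormula n c i W (E.res k W.2.2.1 s),
        fun W W' h => by
          refine (formula_res k (funRes k h) (E.res k h) (E.res_e k h) n p
            (c' := connections c i W') (fun a m => (c (i a)).at_res W.2.1 W'.2.1 _ h m) _).trans ?_
          rw [res_res]⟩
      map_add' s t := AtOver.ext fun W =>
        (congrArg (localFormula n c i W) (map_add (E.res k W.2.2.1) s t)).trans
          (map_add (localFormula n c i W) _ _)
      map_smul' a s := AtOver.ext fun W =>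
        (congrArg (localFormula n c i W) (LinearMap.map_smulₛₗ (E.res k W.2.2.1) a s)).trans
          (map_smul (localFormula n c i W) _ _) }
  naturality V V' h s := AtOver.ext fun W =>
    congrArg (localFormula n c i W) (E.res_res k h W.2.2.1 s)

variable {n} in
lemma formulaHom_app_coe {p : ℕ} (i : Fin (p + 1) ↪o Fin N) (V : X.Opens) (s : E.Sec V)
    (W : AffineIn (inter U i) V) : ((formulaHom n c i).app V s).1 W =
      localFormula n c i W (E.res k W.2.2.1 s) := rfl

lemma formulaHom_hasDegree {p : ℕ} (i : Fin (p + 1) ↪o Fin N) (V : X.Opens) (b : ZMod 2)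
    (s : E.Sec V) (hs : E.HasDegree s b) :
    AtOver.HasDegree ((formulaHom n c i).app V s) (b + p) := fun W q => by
  rw [formulaHom_app_coe]
  refine map_formula_apply k (P := parityProj Γ(X, W.1) Γ(E.E₀, W.1) Γ(E.E₁, W.1))
    (E.e_parityProj W.1) n p (fun a b m => Connection.prod_parityProj _ _ b m) q ?_
  rw [← res_parityProj, hs]

lemma AtOver.coe_zsmul {U V : X.Opens} (a : ℤ) (x : E.AtOver k n U V) (W : AffineIn U V) :
    (a • x).1 W = a • x.1 W := rfl

lemma AtOver.coe_sum {U V : X.Opens} {ι : Type} (S : Finset ι) (x : ι → E.AtOver k n U V)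
    (W : AffineIn U V) : (∑ j ∈ S, x j).1 W = ∑ j ∈ S, (x j).1 W := by
  have := map_sum ((Pi.evalAddMonoidHom (fun W : AffineIn U V => E.AtSec k n W.1) W).comp
    (E.AtOver k n U V).subtype) x S
  exact this

/-- The sign `(-1) ^ q` as an integer and as a function act in the same way. -/
lemma neg_one_pow_zsmul {R G : Type u} [Ring R] [AddCommGroup G] [Module R G] (q : ℕ) (x : G) :
    (-1 : ℤ) ^ q • x = (-1 : R) ^ q • x := by
  obtain h | h := Nat.even_or_odd q <;> simp [h.neg_one_pow]

lemma d_formulaHom {p : ℕ} (i : Fin (p + 1) ↪o Fin N) (V : X.Opens) (s : E.Sec V) :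
    AtOver.d ((formulaHom n c i).app V s) - (-1 : ℤ) ^ p • (formulaHom n c i).app V (E.e V s) =
      Cech.c (fun _ i => (formulaHom n c i).app V s : E.Cech k n U V) p i := by
  refine AtOver.ext fun W => ?_
  change E.atD k n W.1 (localFormula n c i W (E.res k W.2.2.1 s)) -
    (-1 : ℤ) ^ p • localFormula n c i W (E.res k W.2.2.1 (E.e V s)) = _
  rw [res_e, neg_one_pow_zsmul (R := Γ(X, W.1))]
  cases p with
  | zero =>
    rw [pow_zero, one_smul]
    exact d_formula_zero k (E.e W.1) n (E.e_e k W.1) _ _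
  | succ p =>
    refine (d_formula_succ k (E.e W.1) n (E.e_e k W.1) p _ _).trans ?_
    rw [Cech.c, AtOver.coe_sum]
    refine Finset.sum_congr rfl fun j _ => ?_
    rw [AtOver.coe_zsmul, neg_one_pow_zsmul (R := Γ(X, W.1))]
    rfl

namespace CechHom

variable {n} {f : ∀ (p : ℕ) (i : Fin (p + 1) ↪o Fin N), E.AtHom k n (inter U i)}

lemma isDegreeZero_assemble
    (hf : ∀ (p : ℕ) (i : Fin (p + 1) ↪o Fin N) (V : X.Opens) (b : ZMod 2) (s : E.Sec V),
      E.HasDegree s b → AtOver.HasDegree ((f p i).app V s) (b + p)) :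
    (assemble f).IsDegreeZero := fun V b s hs p i W q =>
  (map_smul (Forms.map k q (Coeff.map k _ n q)) _ _).trans
    (congrArg (_ • ·) (hf p i V b s hs W q))

lemma neg_one_pow_triangle_cancel {R G : Type u} [CommRing R] [AddCommGroup G] [Module R G]
    (x y : G) (p : ℕ) :
    (-1 : R) ^ (p * (p - 1) / 2) • x + (-1 : R) ^ (p + 1) • (-1 : R) ^ ((p + 1) * (p + 1 - 1) / 2) •
      (x + (-1 : R) ^ (p + 1) • y) = (-1 : R) ^ ((p + 1) * (p + 1 - 1) / 2) • y := by
  rw [Nat.triangle_succ, pow_add _ (p * (p - 1) / 2), pow_succ]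
  obtain h | h := neg_one_pow_eq_or R p <;> rw [h] <;> module

/-- The signs `(-1) ^ (p (p - 1) / 2)` turn the boundary formulas of the components into the
closedness of their sum. -/
lemma isClosed_assemble
    (hf : ∀ (p : ℕ) (i : Fin (p + 1) ↪o Fin N) (V : X.Opens) (s : E.Sec V),
      AtOver.d ((f p i).app V s) - (-1 : ℤ) ^ p • (f p i).app V (E.e V s) =
        Cech.c (fun q j => (f q j).app V s) p i) :
    (assemble f).IsClosed := fun V s => by
  have hd (p : ℕ) (i : Fin (p + 1) ↪o Fin N) (a : Γ(X, V)) (x : E.AtOver k n (inter U i) V) :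
      AtOver.d (a • x) = a • AtOver.d x :=
    AtOver.ext fun W => map_smul (E.atD k n W.1) _ _
  funext p i
  have h := hf p i V s
  rw [sub_eq_iff_eq_add] at h
  change Cech.c ((assemble f).app V s) p i + (-1 : ℤ) ^ p • AtOver.d
    ((-1 : Γ(X, V)) ^ (p * (p - 1) / 2) • (f p i).app V s) =
      (-1 : Γ(X, V)) ^ (p * (p - 1) / 2) • (f p i).app V (E.e V s)
  rw [hd, h, neg_one_pow_zsmul (R := Γ(X, V)), neg_one_pow_zsmul (R := Γ(X, V))]
  cases p with
  | zero =>
    change 0 + _ • _ • (0 + _) = _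
    simp only [zero_add, pow_zero, one_smul]
  | succ p =>
    have hc : Cech.c ((assemble f).app V s) (p + 1) i = (-1 : Γ(X, V)) ^ (p * (p - 1) / 2) •
        Cech.c (fun q j => (f q j).app V s : E.Cech k n U V) (p + 1) i := by
      rw [Cech.c, Cech.c, Finset.smul_sum]
      refine Finset.sum_congr rfl fun j _ => ?_
      rw [smul_comm]
      rfl
    rw [hc]
    exact neg_one_pow_triangle_cancel _ _ p

end CechHom

end MatrixFactorization

end Geometry

end MatFact

end

theorem mainTheorem9 (k : Type u) [Field k] (X : Scheme.{u}) [X.Over (Spec (.of k))]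
    [Smooth (X ↘ Spec (.of k))] (w : Γ(X, ⊤)) (E : MatFact.MatrixFactorization X w) (n : ℕ)
    (N : ℕ) (U : Fin N → X.Opens) (_hU : ⨆ j, U j = ⊤) (c : ∀ j, E.LocalConnection k (U j)) :
    ∃ f : ∀ (p : ℕ) (i : Fin (p + 1) ↪o Fin N),
        E.AtHom k n (MatFact.MatrixFactorization.inter U i),
      E.IsGivenByFormula k n U c f ∧
      (∀ (p : ℕ) (i : Fin (p + 1) ↪o Fin N) (V : X.Opens) (b : ZMod 2) (s : E.Sec V),
        E.HasDegree s b →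
          MatFact.MatrixFactorization.AtOver.HasDegree ((f p i).app V s) (b + p)) ∧
      (∀ (p : ℕ) (i : Fin (p + 1) ↪o Fin N) (V : X.Opens) (s : E.Sec V),
        MatFact.MatrixFactorization.AtOver.d ((f p i).app V s) -
            (-1 : ℤ) ^ p • (f p i).app V (E.e V s) =
          MatFact.MatrixFactorization.Cech.c (fun q j => (f q j).app V s) p i) ∧
      (MatFact.MatrixFactorization.CechHom.assemble f).IsDegreeZero ∧
      (MatFact.MatrixFactorization.CechHom.assemble f).IsClosed := by
  open MatFact.MatrixFactorization in
  exact ⟨fun _ i => formulaHom n c i, fun _ _ _ _ _ => rfl,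
    fun _ i => formulaHom_hasDegree n c i, fun _ i => d_formulaHom n c i,
    CechHom.isDegreeZero_assemble fun _ i => formulaHom_hasDegree n c i,
    CechHom.isClosed_assemble fun _ i => d_formulaHom n c i⟩
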